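/- **Setting.** Let $K\ge 2$, and let $h:[0,1]\to[0,1]$ with $h(0)=0$ be a distortion function. For a distribution on $\mathbb R$ with CDF $Q$ put $U_h(Q)=\int_{-\infty}^0 (h(1-Q(x))-h(1))\,dx+\int_0^\infty h(1-Q(x))\,dx$, and let $W_1(Q,R)=\int_{\mathbb R}|Q(x)-R(x)|\,dx$ be the 1-Wasserstein distance. The arms are probability distributions $F_1,\dots,F_K$ on a set $S\subseteq[0,\infty)$, each 1-sub-Gaussian (the centered moment generating function is at most $e^{\lambda^2/2}$). Write $\Delta^{K-1}$ for the probability simplex, $V(\alpha)=U_h(\sum_i\alpha(i)F_i)$, and let $\alpha^\star$ maximize $V$ over $\Delta^{K-1}$. Let $W=\sup_{\alpha\ne\alpha'\in\Delta^{K-1}} W_1(\sum_i\alpha(i)F_i,\sum_i\alpha'(i)F_i)/\|\alpha-\alpha'\|_1$. Assume, for some $q\in(0,1]$, $r>0$ and constants $L_H,L_{MH}\ge0$, $B$, $W_{\max}$: - $V\le B$ on $\Delta^{K-1}$, and $W\le W_{\max}$; - (Hölder continuity) $U_h(G_1)-U_h(G_2)\le L_H W_1(G_1,G_2)^q$ for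 all $G_1,G_2$ in the convex hull of the arms $F_i$ and the point masses $\delta_x$, $x\in S$; - (mixture Hölder continuity) $V(\alpha^\star)-U_h(G)\le L_{MH}W_1(\sum_i\alpha^\star(i)F_i,G)^r$ for all $G$ in the convex hull of the arms. Put $L=\max\{L_H,L_{MH}\}$. For $\varepsilon\in(0,1]$ let $\Delta_\varepsilon^{K-1}$ be the set of $a\in\Delta^{K-1}$ whose first $K-1$ coordinates are multiples $\varepsilon n$, $n\in\{0,1,2,\dots\}$ (if $1/\varepsilon$ is an integer, this is the set of all $\varepsilon\mathbf n\in\Delta^{K-1}$ with $\mathbf n\in\{0,1,\dots\}^K$). Let $a^\star$ maximize $V$ over $\Delta_\varepsilon^{K-1}$ and $\Delta_{\min}(\varepsilon)=\min\{V(a^\star)-V(a):a\in\Delta_\varepsilon^{K-1},\,a\ne a^\star\}$. Let $E\subseteq(0,1]$ be a set of discretization levels that accumulates at $0$ (for instance, all $\varepsilon\in(0,\varepsilon_0]$, or all $1/n$ with $n\ge n_0$) along which the gap exponent $\beta=\lim_{\varepsilon\to0,\ \varepsilon\in E}\log\Delta_{\min}(\varepsilon)/\log\varepsilon$ exists and is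 positive, and assume $\Delta_{\min}(\varepsilon)\ge c\,\varepsilon^\beta$ for all $\varepsilon\in E$, where $c>0$. **Algorithm RS-ETC-M** with horizon $T$ and level $\varepsilon$. Let $$N(\varepsilon)=256\,K e\Big(\frac{2KL}{\Delta_{\min}(\varepsilon)}\Big)^{2/q}\Big[\frac{32}{\sqrt e}+\log^{1/2}\big(2KT^2(\varepsilon^{-(K-1)}+1)\big)\Big]^2 .$$ Explore: sample each arm $\lceil N(\varepsilon)/K\rceil$ times, in the first $K\lceil N(\varepsilon)/K\rceil$ rounds. Choose some $a\in\Delta_\varepsilon^{K-1}$ that maximizes $U_h(\sum_i a(i)\widehat F_i)$, where $\widehat F_i$ are the empirical CDFs after exploration. Commit, up to round $T$: in each round select the first arm $i\in\{1,\dots,K-1\}$ that has been selected fewer than $\lfloor T a(i)\rfloor$ times so far; if there is none, select arm $K$. The rewards of all arms are independent, those of arm $i$ having law $F_i$. With $\tau_T(i)$ the number of selections of arm $i$ in $T$ rounds, the regret is $\mathfrak R(T)=V(\alpha^\star)-\mathbb E[V(\tau_T/T)]$. **Theorem.** Let $\gamma=\frac{2\beta}{2\beta+r}$, $c_E=2\big(1+\frac{\beta+1}{q}\big)$,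 and $0<c_1\le c_2$. There are constants $C$ and $T_0$ that depend only on $q,r,\beta,L_H,L_{MH},B,W_{\max},c,c_1,c_2$ (not on $K$, $h$, the arms or $E$) such that the following holds for every $T\ge T_0$ and every $\varepsilon\in E$ with $$c_1\big(K^{2+2/q}T^{-\gamma}\log T\big)^{q/(2\beta)}\le\varepsilon\le c_2\big(K^{2+2/q}T^{-\gamma}\log T\big)^{q/(2\beta)} .$$ The choice of $\varepsilon$ is feasible, that is, $N(\varepsilon)<T$ and $K\lceil N(\varepsilon)/K\rceil\le T$, and the regret of RS-ETC-M with level $\varepsilon$ satisfies $$\mathfrak R(T)\le C\Big[K^{c_E}\,\frac{\log T}{T^{\gamma}}\Big]^{\frac{qr}{2\beta}} .$$ -/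

import Mathlib

open MeasureTheory ProbabilityTheory Filter Topology

namespace RSBandit

noncomputable section

/-- The distortion riskmetric `U_h`, a signed Choquet integral, as a functional of the cumulative
distribution function `Q`. -/
def distortionRisk (h : ℝ → ℝ) (Q : ℝ → ℝ) : ℝ :=
  (∫ x in Set.Iio (0 : ℝ), (h (1 - Q x) - h 1)) + ∫ x in Set.Ioi (0 : ℝ), h (1 - Q x)

/-- The `1`-Wasserstein distance of two probability distributions on the real line with finite
first moment, in terms of their cumulative distribution functions. -/
def wasserstein (Q R : ℝ → ℝ) : ℝ := ∫ x, |Q x - R x|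

/-- The mixture `∑ i, α i • Q i` of distribution functions. -/
def mix {K : ℕ} (Q : Fin K → ℝ → ℝ) (α : Fin K → ℝ) : ℝ → ℝ := fun x => ∑ i, α i * Q i x

/-- The cumulative distribution functions of the arms. -/
def armCDF {K : ℕ} (F : Fin K → Measure ℝ) (i : Fin K) : ℝ → ℝ := fun x => cdf (F i) x

/-- `V(α, F) = U_h(∑ i, α i • F i)`. -/
def mixValue {K : ℕ} (h : ℝ → ℝ) (F : Fin K → Measure ℝ) (α : Fin K → ℝ) : ℝ :=
  distortionRisk h (mix (armCDF F) α)

/-- `α` is an optimal vector of mixing coefficients. -/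
def IsOptimalMixture {K : ℕ} (h : ℝ → ℝ) (F : Fin K → Measure ℝ) (α : Fin K → ℝ) : Prop :=
  α ∈ stdSimplex ℝ (Fin K) ∧ ∀ α' ∈ stdSimplex ℝ (Fin K), mixValue h F α' ≤ mixValue h F α

/-- `W`: the largest ratio of the Wasserstein distance of two mixtures of the arms and the
`ℓ¹`-distance of their coefficient vectors. -/
def wassersteinRatio {K : ℕ} (F : Fin K → Measure ℝ) : ℝ :=
  sSup {w | ∃ α ∈ stdSimplex ℝ (Fin K), ∃ α' ∈ stdSimplex ℝ (Fin K), α ≠ α' ∧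
    w = wasserstein (mix (armCDF F) α) (mix (armCDF F) α') / ∑ i, |α i - α' i|}

/-- The distribution functions of the convex hull of the arms and of the point masses at the
points of the sample space `S`; it contains all mixtures of the arms and all mixtures of
empirical distributions of samples of the arms. -/
def sampleHull {K : ℕ} (S : Set ℝ) (F : Fin K → Measure ℝ) : Set (ℝ → ℝ) :=
  convexHull ℝ (Set.range (armCDF F) ∪ {Q | ∃ x ∈ S, Q = fun y => cdf (Measure.dirac x) y})

/-- Hölder continuity of `U_h`, with exponent `q` and constant `L`, on a class of distributions. -/
def IsHolderDR (h : ℝ → ℝ) (q L : ℝ) (Ξ : Set (ℝ → ℝ)) : Prop :=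
  ∀ Q ∈ Ξ, ∀ R ∈ Ξ, distortionRisk h Q - distortionRisk h R ≤ L * wasserstein Q R ^ q

/-- Mixture Hölder continuity of `U_h` at the mixture with coefficients `αs`, with exponent `r`
and constant `L`, on the convex hull of the arms. -/
def IsMixtureHolderDR {K : ℕ} (h : ℝ → ℝ) (F : Fin K → Measure ℝ) (αs : Fin K → ℝ)
    (r L : ℝ) : Prop :=
  ∀ Q ∈ convexHull ℝ (Set.range (armCDF F)),
    mixValue h F αs - distortionRisk h Q ≤ L * wasserstein (mix (armCDF F) αs) Q ^ r

/-- The discrete simplex of level `ε`: all coordinates but the last one are natural multiples of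
`ε`, and the last one makes up for the rest.  If `1 / ε` is an integer, then the last coordinate
is automatically a natural multiple of `ε` as well. -/
def discreteSimplex (K : ℕ) (ε : ℝ) : Set (Fin K → ℝ) :=
  {a | a ∈ stdSimplex ℝ (Fin K) ∧ ∀ i : Fin K, i.val + 1 < K → ∃ n : ℕ, a i = ε * n}

/-- The minimum sub-optimality gap `Δ_min(ε)`: the least value of `V(a*, F) - V(a, F)` over the
points `a ≠ a*` of the discrete simplex, where `a*` is a discrete optimal mixture.  (The value
does not depend on the choice of `a*`.) -/
def minGap {K : ℕ} (h : ℝ → ℝ) (F : Fin K → Measure ℝ) (ε : ℝ) : ℝ :=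
  sInf {d | ∃ a' ∈ discreteSimplex K ε,
    (∀ b ∈ discreteSimplex K ε, mixValue h F b ≤ mixValue h F a') ∧
    ∃ a ∈ discreteSimplex K ε, a ≠ a' ∧ d = mixValue h F a' - mixValue h F a}

/-- The length `N(ε)` of the exploration phase, for `K` arms, Hölder exponent `q`, Hölder constant
`L`, minimum gap `Δ` at the level `ε`, and horizon `T`. -/
def explorationLength (K : ℕ) (q L Δ ε : ℝ) (T : ℕ) : ℝ :=
  256 * K * Real.exp 1 * (2 * K * L / Δ) ^ (2 / q) *
    (32 / √(Real.exp 1) + √(Real.log (2 * K * (T : ℝ) ^ 2 * ((ε ^ (K - 1))⁻¹ + 1)))) ^ 2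

/-- The number of times arm `i` is selected in the first `t` rounds by the arm sequence `A`. -/
def pullCount {K : ℕ} (A : ℕ → Fin K) (t : ℕ) (i : Fin K) : ℕ :=
  ((Finset.range t).filter fun s => A s = i).card

/-- The reward that is observed in round `s` (rounds are numbered from `0`); `x i n` is the
reward that arm `i` generates at its selection number `n`. -/
def reward {K : ℕ} (A : ℕ → Fin K) (x : Fin K → ℕ → ℝ) (s : ℕ) : ℝ :=
  x (A s) (pullCount A s (A s))

/-- The empirical distribution function of arm `i` after `t` rounds. -/
def empiricalCDF {K : ℕ} (A : ℕ → Fin K) (x : Fin K → ℕ → ℝ) (t : ℕ) (i : Fin K) : ℝ → ℝ :=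
  fun y => (((Finset.range t).filter fun s => A s = i ∧ reward A x s ≤ y).card : ℝ)
    / (pullCount A t i : ℝ)

/-- The commit rule in round `t` for the horizon `T` and the coefficients `a`: select the first
arm, among all but the last one, that has been selected fewer than `⌊T a(i)⌋` times; if there is
none, select the last arm. -/
def CommitRule {K : ℕ} (T : ℕ) (a : Fin K → ℝ) (A : ℕ → Fin K) (t : ℕ) : Prop :=
  (∀ i : Fin K, i.val + 1 < K → pullCount A t i < ⌊(T : ℝ) * a i⌋₊ → A t ≤ i) ∧
  ((A t).val + 1 < K → pullCount A t (A t) < ⌊(T : ℝ) * a (A t)⌋₊)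

/-- The arm sequence `A` is produced by the algorithm RS-ETC-M when the arms generate the rewards
`x`: each arm is selected `⌈N / K⌉` times (in some order) in the first `K ⌈N / K⌉` rounds, then
some `a` is chosen that maximizes the riskmetric of the empirical mixture over the discrete
simplex, and the rounds up to the horizon `T` follow the commit rule for `a`. -/
structure FollowsRSETCM {K : ℕ} (h : ℝ → ℝ) (ε N : ℝ) (T : ℕ)
    (x : Fin K → ℕ → ℝ) (A : ℕ → Fin K) : Prop where
  explore : ∀ i, pullCount A (K * ⌈N / K⌉₊) i = ⌈N / K⌉₊
  commit : ∃ a ∈ discreteSimplex K ε,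
    (∀ b ∈ discreteSimplex K ε,
      distortionRisk h (mix (empiricalCDF A x (K * ⌈N / K⌉₊)) b)
        ≤ distortionRisk h (mix (empiricalCDF A x (K * ⌈N / K⌉₊)) a)) ∧
    ∀ t, K * ⌈N / K⌉₊ ≤ t → t < T → CommitRule T a A t

/-- The regret at the horizon `T` of the (random) arm sequence `A` against the oracle mixture
`αs`. -/
def regret {K : ℕ} {Ω : Type*} [MeasurableSpace Ω] (P : Measure Ω) (h : ℝ → ℝ)
    (F : Fin K → Measure ℝ) (αs : Fin K → ℝ) (A : ℕ → Ω → Fin K) (T : ℕ) : ℝ :=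
  mixValue h F αs -
    ∫ ω, mixValue h F (fun i => (pullCount (fun t => A t ω) T i : ℝ) / (T : ℝ)) ∂P

/-- A bandit model: `X i n` is the `n`-th reward of arm `i`; all rewards are independent, and
those of arm `i` have the law `F i`. -/
structure IsRewardModel {K : ℕ} {Ω : Type*} [MeasurableSpace Ω] (P : Measure Ω)
    (F : Fin K → Measure ℝ) (X : Fin K → ℕ → Ω → ℝ) : Prop where
  measurable : ∀ i n, Measurable (X i n)
  law : ∀ i n, P.map (X i n) = F i
  indep : iIndepFun (fun p : Fin K × ℕ => X p.1 p.2) P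

/-- The standing assumptions on an instance with `K` arms: `h` is a distortion function, the arms
`F` are `1`-sub-Gaussian distributions on the set `S` of nonnegative reals, `αs` is an optimal
mixture, `U_h` is bounded by `B` on the mixtures of the arms, Hölder continuous (exponent `q`,
constant `LH`) and mixture Hölder continuous (exponent `r`, constant `LMH`), and the ratio `W` is
at most `Wmax`. -/
structure StandingAssumptions {K : ℕ} (q r LH LMH B Wmax : ℝ) (h : ℝ → ℝ) (S : Set ℝ)
    (F : Fin K → Measure ℝ) (αs : Fin K → ℝ) : Prop where
  two_le : 2 ≤ K
  h_zero : h 0 = 0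
  h_mem : ∀ u ∈ Set.Icc (0 : ℝ) 1, h u ∈ Set.Icc (0 : ℝ) 1
  nonneg : S ⊆ Set.Ici 0
  prob : ∀ i, IsProbabilityMeasure (F i)
  mem : ∀ i, ∀ᵐ x ∂(F i), x ∈ S
  subGaussian : ∀ i, HasSubgaussianMGF (fun x => x - ∫ y, y ∂(F i)) 1 (F i)
  bounded : ∀ α ∈ stdSimplex ℝ (Fin K), mixValue h F α ≤ B
  optimal : IsOptimalMixture h F αs
  holder : IsHolderDR h q LH (sampleHull S F)
  mixtureHolder : IsMixtureHolderDR h F αs r LMH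
  ratio_le : wassersteinRatio F ≤ Wmax

/-- The gap exponent along the set `E` of discretization levels is `β`: the limit of
`log Δ_min(ε) / log ε`, as `ε` tends to `0` in `E`, exists and equals `β`. -/
def HasGapExponent {K : ℕ} (h : ℝ → ℝ) (F : Fin K → Measure ℝ) (E : Set ℝ) (β : ℝ) : Prop :=
  (𝓝[E] (0 : ℝ)).NeBot ∧
    Tendsto (fun ε => Real.log (minGap h F ε) / Real.log ε) (𝓝[E] 0) (𝓝 β)

/-- The exponent `γ = 2β / (2β + r)`. -/
def gammaExp (β r : ℝ) : ℝ := 2 * β / (2 * β + r)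

/-- The exponent `c_E = 2 (1 + (β + 1) / q)`. -/
def cE (β q : ℝ) : ℝ := 2 * (1 + (β + 1) / q)

/-- The order `(K ^ (2 + 2/q) T ^ (-γ) log T) ^ (q / (2β))` of the discretization level. -/
def levelOrder (q r β : ℝ) (K T : ℕ) : ℝ :=
  ((K : ℝ) ^ (2 + 2 / q) * (T : ℝ) ^ (-gammaExp β r) * Real.log T) ^ (q / (2 * β))

end

end RSBandit

open RSBandit

namespace RSBandit

/-! ### Concentration of Lipschitz functions of independent sub-Gaussian variables -/

section Tensorization

variable {μ : Measure ℝ}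

/-! The regret splits into three losses, collected in `StandingAssumptions.regret_le`.

Discretization: rounding `αs` into the grid moves it by at most `2Kε` in `ℓ¹`, so mixture Hölder
continuity costs `O((Kε)^r)`.

Commitment: if the grid optimum is selected, the commit rule brings the final fractions within
`O((Km + K)/T)` of it, where `m` is the exploration count per arm. Hölder continuity turns this into
a `q`-th power.

Failure: the values of `V` at mixtures lie in `[0, B]`, so a wrong selection costs at most `B` times
its probability.

A wrong selection requires some empirical arm to be at distance at least `t` from its law, where
`t^q` is of the order of the gap divided by `L`. Convexity of the Wasserstein distance transfers the
precision of the arms to all mixtures at once, so a union over the `K` arms suffices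
(`StandingAssumptions.selection_correct`). For one arm, the distance between empirical and true law
is a `1/n`-Lipschitz function of the sample in `ℓ¹`. It therefore concentrates around its mean
(`tail_le_of_l1_lipschitz`), and the mean is at most `4/√n` because the pointwise standard deviation
`√(F(1-F)/n)` has Gaussian decay (`integral_wasserstein_sampleCDF_le`).

Write `M` for `levelBase`. A level of order `M^(q/(2β))` makes the gap at least of order `M^(q/2)`,
hence the exploration length `O(T^γ)`. The identity `1 - γ = γ r/(2β)` then makes the commitment
loss comparable to the discretization loss. -/

lemma integrable_exp_mul_of_subgaussian
    (hμ : HasSubgaussianMGF (fun x => x - ∫ y, y ∂μ) 1 μ) (t : ℝ) :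
    Integrable (fun x => Real.exp (t * x)) μ := by
  have h := (hμ.integrable_exp_mul t).mul_const (Real.exp (t * ∫ y, y ∂μ))
  refine h.congr (ae_of_all _ fun x => ?_)
  simp only [← Real.exp_add]
  ring_nf

lemma integral_exp_mul_le_of_subgaussian
    (hμ : HasSubgaussianMGF (fun x => x - ∫ y, y ∂μ) 1 μ) (t : ℝ) :
    ∫ x, Real.exp (t * x) ∂μ ≤ Real.exp (t * ∫ y, y ∂μ) * Real.exp (t ^ 2 / 2) := by
  have h := hμ.mgf_le t
  rw [mgf] at h
  have e : ∀ x : ℝ, Real.exp (t * x)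
      = Real.exp (t * ∫ y, y ∂μ) * Real.exp (t * (x - ∫ y, y ∂μ)) := fun x => by
    rw [← Real.exp_add]; ring_nf
  rw [integral_congr_ae (ae_of_all _ e), integral_const_mul]
  gcongr
  simpa using h

variable [IsProbabilityMeasure μ]

lemma integrable_id_of_subgaussian
    (hμ : HasSubgaussianMGF (fun x => x - ∫ y, y ∂μ) 1 μ) : Integrable (fun x : ℝ => x) μ := by
  refine (hμ.integrable.add (integrable_const (∫ y, y ∂μ))).congr (ae_of_all _ fun x => ?_)
  simp

/-- A real function that is Lipschitz has the moment generating function bound of the symmetrized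
variable. -/
lemma integral_exp_le_of_lipschitz
    (hμ : HasSubgaussianMGF (fun x => x - ∫ y, y ∂μ) 1 μ) {g : ℝ → ℝ} {c : ℝ}
    (hg : ∀ x y, |g x - g y| ≤ c * |x - y|)
    (hgi : Integrable g μ) (hp : Integrable (fun x => Real.exp (g x)) μ)
    (hn : Integrable (fun x => Real.exp (-g x)) μ) :
    ∫ x, Real.exp (g x) ∂μ ≤ Real.exp (∫ x, g x ∂μ + c ^ 2) := by
  have jensen : Real.exp (-∫ x, g x ∂μ) ≤ ∫ x, Real.exp (-g x) ∂μ := by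
    have := convexOn_exp.map_integral_le (μ := μ) (f := fun x => -g x)
      Real.continuous_exp.continuousOn isClosed_univ (by simp) hgi.neg hn
    rwa [integral_neg] at this
  have ip := integrable_exp_mul_of_subgaussian hμ c
  have im : Integrable (fun x => Real.exp (-(c * x))) μ := by
    simpa using integrable_exp_mul_of_subgaussian hμ (-c)
  -- Symmetrization: with an independent copy `y`, both sides are means of hyperbolic cosines, of `g
  -- x - g y` and of `c (x - y)`, and `cosh` is monotone in the absolute value of its argument.
  -- Jensen removes the second factor on the left afterwards.
  have key : (∫ x, Real.exp (g x) ∂μ) * ∫ y, Real.exp (-g y) ∂μ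
      ≤ (∫ x, Real.exp (c * x) ∂μ) * ∫ y, Real.exp (-(c * y)) ∂μ := by
    have e1 : 2 * ((∫ x, Real.exp (g x) ∂μ) * ∫ y, Real.exp (-g y) ∂μ)
        = ∫ z, (Real.exp (g z.1) * Real.exp (-g z.2) + Real.exp (-g z.1) * Real.exp (g z.2))
            ∂(μ.prod μ) := by
      rw [integral_add (hp.mul_prod hn) (hn.mul_prod hp), 
        integral_prod_mul (fun x => Real.exp (g x)) (fun x => Real.exp (-g x)),
        integral_prod_mul (fun x => Real.exp (-g x)) (fun x => Real.exp (g x))]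
      ring
    have e2 : 2 * ((∫ x, Real.exp (c * x) ∂μ) * ∫ y, Real.exp (-(c * y)) ∂μ)
        = ∫ z, (Real.exp (c * z.1) * Real.exp (-(c * z.2))
            + Real.exp (-(c * z.1)) * Real.exp (c * z.2)) ∂(μ.prod μ) := by
      rw [integral_add (ip.mul_prod im) (im.mul_prod ip),
        integral_prod_mul (fun x => Real.exp (c * x)) (fun x => Real.exp (-(c * x))),
        integral_prod_mul (fun x => Real.exp (-(c * x))) (fun x => Real.exp (c * x))]
      ring
    have : 2 * ((∫ x, Real.exp (g x) ∂μ) * ∫ y, Real.exp (-g y) ∂μ)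
        ≤ 2 * ((∫ x, Real.exp (c * x) ∂μ) * ∫ y, Real.exp (-(c * y)) ∂μ) := by
      rw [e1, e2]
      refine integral_mono ((hp.mul_prod hn).add (hn.mul_prod hp))
        ((ip.mul_prod im).add (im.mul_prod ip)) fun z => ?_
      simp only [← Real.exp_add]
      have h := Real.cosh_le_cosh.2 ((hg z.1 z.2).trans ((le_abs_self _).trans_eq
        (show abs (c * abs (z.1 - z.2)) = abs (c * (z.1 - z.2)) by simp [abs_mul])))
      rw [Real.cosh_eq, Real.cosh_eq] at h
      have r1 : g z.1 + -g z.2 = g z.1 - g z.2 := by ring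
      have r2 : -g z.1 + g z.2 = -(g z.1 - g z.2) := by ring
      have r3 : c * z.1 + -(c * z.2) = c * (z.1 - z.2) := by ring
      have r4 : -(c * z.1) + c * z.2 = -(c * (z.1 - z.2)) := by ring
      rw [r1, r2, r3, r4]
      linarith
    linarith
  have b1 := integral_exp_mul_le_of_subgaussian hμ c
  have b2 := integral_exp_mul_le_of_subgaussian hμ (-c)
  simp only [neg_mul] at b2
  have b3 : (∫ x, Real.exp (c * x) ∂μ) * ∫ y, Real.exp (-(c * y)) ∂μ ≤ Real.exp (c ^ 2) := by
    refine (mul_le_mul b1 b2 (integral_nonneg fun _ => (Real.exp_pos _).le)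
      (by positivity)).trans_eq ?_
    simp only [← Real.exp_add]
    ring_nf
  have h0 : 0 ≤ ∫ x, Real.exp (g x) ∂μ := integral_nonneg fun _ => (Real.exp_pos _).le
  have h1 := (mul_le_mul_of_nonneg_left jensen h0).trans (key.trans b3)
  rw [Real.exp_neg, ← div_eq_mul_inv, div_le_iff₀ (Real.exp_pos _)] at h1
  rwa [Real.exp_add, mul_comm]

lemma continuous_of_l1_lipschitz {n : ℕ} {f : (Fin n → ℝ) → ℝ} {c : ℝ}
    (hf : ∀ x y, |f x - f y| ≤ c * ∑ i, |x i - y i|) : Continuous f := by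
  refine continuous_iff_continuousAt.2 fun x => ?_
  rw [ContinuousAt, tendsto_iff_dist_tendsto_zero]
  have h : Tendsto (fun y : Fin n → ℝ => c * ∑ i, |y i - x i|) (𝓝 x) (𝓝 0) := by
    have : Continuous fun y : Fin n → ℝ => c * ∑ i, |y i - x i| := by fun_prop
    simpa using this.tendsto x
  exact squeeze_zero (fun _ => dist_nonneg) (fun y => by rw [Real.dist_eq]; exact hf y x) h

/-- Comparison with the origin dominates `exp (f x)` by `exp (f 0) * ∏ exp (c |x i|)`, a product of
integrable one-variable functions. -/
lemma integrable_exp_of_l1_lipschitz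
    (hμ : HasSubgaussianMGF (fun x => x - ∫ y, y ∂μ) 1 μ) {n : ℕ} {f : (Fin n → ℝ) → ℝ} {c : ℝ}
    (hf : ∀ x y, |f x - f y| ≤ c * ∑ i, |x i - y i|) :
    Integrable (fun x => Real.exp (f x)) (Measure.pi fun _ : Fin n => μ) := by
  have h1 : Integrable (fun x : ℝ => Real.exp (c * |x|)) μ :=
    integrable_exp_mul_abs (integrable_exp_mul_of_subgaussian hμ c)
      (integrable_exp_mul_of_subgaussian hμ (-c))
  have h2 : Integrable (fun x : Fin n → ℝ => ∏ i, Real.exp (c * |x i|))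
      (Measure.pi fun _ : Fin n => μ) := Integrable.fintype_prod (fun _ => h1)
  refine (h2.const_mul (Real.exp (f 0))).mono'
    (Real.continuous_exp.comp (continuous_of_l1_lipschitz hf)).aestronglyMeasurable
    (ae_of_all _ fun x => ?_)
  rw [Real.norm_eq_abs, abs_of_pos (Real.exp_pos _), ← Real.exp_sum, ← Real.exp_add,
    ← Finset.mul_sum]
  refine Real.exp_le_exp.2 ?_
  have := (le_abs_self _).trans (hf x 0)
  simp only [Pi.zero_apply, sub_zero] at this
  linarith

lemma integrable_of_l1_lipschitz
    (hμ : HasSubgaussianMGF (fun x => x - ∫ y, y ∂μ) 1 μ) {n : ℕ} {f : (Fin n → ℝ) → ℝ} {c : ℝ}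
    (hf : ∀ x y, |f x - f y| ≤ c * ∑ i, |x i - y i|) :
    Integrable f (Measure.pi fun _ : Fin n => μ) := by
  have hf' : ∀ x y, |-f x - -f y| ≤ c * ∑ i, |x i - y i| := fun x y => by
    rw [← abs_neg]; convert hf x y using 2; ring
  refine ((integrable_exp_of_l1_lipschitz hμ hf).add
    (integrable_exp_of_l1_lipschitz hμ hf')).mono'
    (continuous_of_l1_lipschitz hf).aestronglyMeasurable (ae_of_all _ fun x => ?_)
  simp only [Pi.add_apply, Real.norm_eq_abs]
  refine abs_le.2 ⟨?_, ?_⟩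
  · linarith [Real.add_one_le_exp (-f x), Real.exp_pos (f x)]
  · linarith [Real.add_one_le_exp (f x), Real.exp_pos (-f x)]

/-- Tensorization of the moment generating function bound over the coordinates of a product. -/
lemma integral_exp_le_of_l1_lipschitz
    (hμ : HasSubgaussianMGF (fun x => x - ∫ y, y ∂μ) 1 μ) {c : ℝ} (n : ℕ) :
    ∀ f : (Fin n → ℝ) → ℝ, (∀ x y, |f x - f y| ≤ c * ∑ i, |x i - y i|) →
      ∫ x, Real.exp (f x) ∂(Measure.pi fun _ : Fin n => μ)
        ≤ Real.exp (∫ x, f x ∂(Measure.pi fun _ : Fin n => μ) + n * c ^ 2) := by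
  induction n with
  | zero =>
    intro f _
    have : ∀ x, f x = f 0 := fun x => congrArg f (Subsingleton.elim _ _)
    simp_rw [this]
    simp
  | succ n ih =>
    intro f hf
    have mp := (measurePreserving_piFinSuccAbove (fun _ : Fin (n + 1) => μ) 0).symm
    have push : ∀ F : (Fin (n + 1) → ℝ) → ℝ,
        ∫ x, F x ∂(Measure.pi fun _ : Fin (n + 1) => μ)
          = ∫ z : ℝ × (Fin n → ℝ), F (Fin.cons z.1 z.2)
              ∂(μ.prod (Measure.pi fun _ : Fin n => μ)) := fun F => by
      rw [← mp.integral_comp']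
      simp [MeasurableEquiv.piFinSuccAbove_symm_apply, Fin.insertNthEquiv]
    have pushi : ∀ F : (Fin (n + 1) → ℝ) → ℝ,
        Integrable F (Measure.pi fun _ : Fin (n + 1) => μ) →
        Integrable (fun z : ℝ × (Fin n → ℝ) => F (Fin.cons z.1 z.2))
              (μ.prod (Measure.pi fun _ : Fin n => μ)) := fun F hF => by
      rw [← mp.integrable_comp_emb (MeasurableEquiv.measurableEmbedding _)] at hF
      simpa [MeasurableEquiv.piFinSuccAbove_symm_apply, Fin.insertNthEquiv, Function.comp_def]
        using hF
    have i1 := pushi _ (integrable_of_l1_lipschitz hμ hf)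
    have i2 := pushi _ (integrable_exp_of_l1_lipschitz hμ hf)
    have s1 : ∀ v : Fin n → ℝ, ∀ x y : ℝ,
        |f (Fin.cons x v) - f (Fin.cons y v)| ≤ c * |x - y| := fun v x y => by
      simpa [Fin.sum_univ_succ] using hf (Fin.cons x v) (Fin.cons y v)
    have s2 : ∀ x : ℝ, ∀ v w : Fin n → ℝ,
        |f (Fin.cons x v) - f (Fin.cons x w)| ≤ c * ∑ i, |v i - w i| := fun x v w => by
      simpa [Fin.sum_univ_succ] using hf (Fin.cons x v) (Fin.cons x w)
    -- The one-variable integrability facts are the case `n = 1` of the product lemmas, transported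
    -- along the evaluation map.
    have lift1 : ∀ g : ℝ → ℝ, (∀ x y, |g x - g y| ≤ c * |x - y|) →
        ∀ x y : Fin 1 → ℝ, |g (x 0) - g (y 0)| ≤ c * ∑ i, |x i - y i| := fun g hg x y => by
      simpa using hg (x 0) (y 0)
    have emb := (measurePreserving_eval (fun _ : Fin 1 => μ) 0)
    have one : ∀ g : ℝ → ℝ, Continuous g →
        Integrable (fun x : Fin 1 → ℝ => g (x 0)) (Measure.pi fun _ : Fin 1 => μ) →
        Integrable g μ := fun g hg hi => by
      rw [← emb.integrable_comp hg.aestronglyMeasurable]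
      exact hi
    have hcont : ∀ g : ℝ → ℝ, (∀ x y, |g x - g y| ≤ c * |x - y|) → Continuous g := fun g hg => by
      have := (continuous_of_l1_lipschitz (lift1 g hg)).comp
        (continuous_pi fun _ : Fin 1 => continuous_id (X := ℝ))
      simpa [Function.comp_def] using this
    have gi : ∀ g : ℝ → ℝ, (∀ x y, |g x - g y| ≤ c * |x - y|) → Integrable g μ := fun g hg =>
      one g (hcont g hg) (integrable_of_l1_lipschitz hμ (lift1 g hg))
    have ge : ∀ g : ℝ → ℝ, (∀ x y, |g x - g y| ≤ c * |x - y|) →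
        Integrable (fun x => Real.exp (g x)) μ := fun g hg =>
      one _ (Real.continuous_exp.comp (hcont g hg))
        (integrable_exp_of_l1_lipschitz hμ (lift1 g hg))
    -- Integrating out the first coordinate keeps the Lipschitz constant, so the induction
    -- hypothesis applies to `G` with the same `c`; the inner integral costs one factor `exp (c ^
    -- 2)`.
    set G : (Fin n → ℝ) → ℝ := fun v => ∫ x, f (Fin.cons x v) ∂μ with hG
    have hGl : ∀ v w, |G v - G w| ≤ c * ∑ i, |v i - w i| := fun v w => by
      rw [hG]
      simp only
      rw [← integral_sub (gi _ (s1 v)) (gi _ (s1 w))]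
      refine (norm_integral_le_of_norm_le_const (μ := μ) (C := c * ∑ i, |v i - w i|)
        (f := fun x => f (Fin.cons x v) - f (Fin.cons x w))
        (ae_of_all _ fun x => s2 x v w)).trans_eq ?_
      simp
    rw [push, push, integral_prod_symm _ i1, integral_prod_symm _ i2]
    have step : ∀ v, ∫ x, Real.exp (f (Fin.cons x v)) ∂μ ≤ Real.exp (c ^ 2) * Real.exp (G v) :=
      fun v => by
        have hneg : ∀ x y : ℝ, |-f (Fin.cons x v) - -f (Fin.cons y v)| ≤ c * |x - y| :=
          fun x y => by
            rw [← abs_neg]; convert s1 v x y using 2; ring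
        refine (integral_exp_le_of_lipschitz hμ (s1 v) (gi _ (s1 v)) (ge _ (s1 v))
          (ge _ hneg)).trans_eq ?_
        rw [← Real.exp_add, add_comm]
    refine (integral_mono i2.integral_prod_right
      ((integrable_exp_of_l1_lipschitz hμ hGl).const_mul _) step).trans ?_
    rw [integral_const_mul]
    refine (mul_le_mul_of_nonneg_left (ih G hGl) (Real.exp_pos _).le).trans_eq ?_
    rw [← Real.exp_add]
    congr 1
    push_cast
    ring

/-- An `ℓ¹`-Lipschitz function of independent sub-Gaussian variables is sub-Gaussian around its
mean. -/
lemma tail_le_of_l1_lipschitz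
    (hμ : HasSubgaussianMGF (fun x => x - ∫ y, y ∂μ) 1 μ) {n : ℕ} (hn : 0 < n)
    {f : (Fin n → ℝ) → ℝ} (hf : ∀ x y, |f x - f y| ≤ (n : ℝ)⁻¹ * ∑ i, |x i - y i|)
    {s : ℝ} (hs : 0 ≤ s) :
    (Measure.pi fun _ : Fin n => μ).real
        {x | s ≤ f x - ∫ y, f y ∂(Measure.pi fun _ : Fin n => μ)}
      ≤ Real.exp (-(n * s ^ 2 / 4)) := by
  set m := ∫ y, f y ∂(Measure.pi fun _ : Fin n => μ) with hm
  have hn' : (0 : ℝ) < n := by exact_mod_cast hn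
  have hl : ∀ t : ℝ, ∀ x y, |t * f x - t * f y| ≤ (|t| * (n : ℝ)⁻¹) * ∑ i, |x i - y i| :=
    fun t x y => by
      rw [← mul_sub, abs_mul, mul_assoc]
      exact mul_le_mul_of_nonneg_left (hf x y) (abs_nonneg t)
  -- For `t * f` the Lipschitz constant is `|t|/n`, so the exponent is `n (t/n)² = (2/n) t²/2`,
  -- which is the variance proxy `2/n`.
  have hsub : HasSubgaussianMGF (fun x => f x - m) (2 / n) (Measure.pi fun _ : Fin n => μ) := by
    have e : ∀ t : ℝ, ∀ x, Real.exp (t * (f x - m)) = Real.exp (-(t * m)) * Real.exp (t * f x) :=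
      fun t x => by rw [← Real.exp_add]; ring_nf
    refine ⟨fun t => ?_, fun t => ?_⟩
    · simp_rw [e]
      exact (integrable_exp_of_l1_lipschitz hμ (hl t)).const_mul _
    · rw [mgf]
      simp_rw [e]
      rw [integral_const_mul]
      refine (mul_le_mul_of_nonneg_left (integral_exp_le_of_l1_lipschitz hμ n _ (hl t))
        (Real.exp_pos _).le).trans_eq ?_
      rw [← Real.exp_add, integral_const_mul, ← hm, mul_pow, sq_abs]
      congr 1
      push_cast
      field_simp
      ring
  refine (hsub.measure_ge_le hs).trans_eq ?_
  congr 1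
  push_cast
  field_simp
  ring

end Tensorization

/-! ### Distribution functions and the Wasserstein distance -/

/-- The distribution function of the point mass at `y`. -/
noncomputable def stepFun (y u : ℝ) : ℝ := if y ≤ u then 1 else 0

lemma stepFun_nonneg (y u : ℝ) : 0 ≤ stepFun y u := by
  unfold stepFun; split_ifs <;> norm_num

lemma stepFun_le_one (y u : ℝ) : stepFun y u ≤ 1 := by
  unfold stepFun; split_ifs <;> norm_num

lemma measurable_stepFun : Measurable fun p : ℝ × ℝ => stepFun p.1 p.2 :=
  Measurable.ite (measurableSet_le measurable_fst measurable_snd) measurable_const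
    measurable_const

lemma measurable_stepFun_left (u : ℝ) : Measurable fun y => stepFun y u :=
  measurable_stepFun.comp (measurable_id.prodMk measurable_const)

lemma measurable_stepFun_right (y : ℝ) : Measurable fun u => stepFun y u :=
  measurable_stepFun.comp (measurable_const.prodMk measurable_id)

lemma cdf_dirac_eq (y : ℝ) : (fun u => cdf (Measure.dirac y) u) = stepFun y := by
  funext u
  rw [cdf_eq_real, measureReal_def, Measure.dirac_apply' _ measurableSet_Iic]
  by_cases h : y ≤ u <;> simp [stepFun, h]

lemma integral_stepFun (μ : Measure ℝ) [IsProbabilityMeasure μ] (u : ℝ) :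
    ∫ y, stepFun y u ∂μ = cdf μ u := by
  have : (fun y => stepFun y u) = (Set.Iic u).indicator fun _ => (1 : ℝ) := by
    funext y
    by_cases h : y ≤ u <;> simp [stepFun, h]
  rw [this, integral_indicator_const _ measurableSet_Iic, cdf_eq_real]
  simp

lemma stepFun_sub_eq {y z : ℝ} (h : y ≤ z) :
    (fun u => stepFun y u - stepFun z u) = (Set.Ico y z).indicator fun _ => (1 : ℝ) := by
  funext u
  by_cases h1 : y ≤ u <;> by_cases h2 : z ≤ u
  · simp [stepFun, h1, h2]
  · simp [stepFun, h1, not_le.1 h2, h2]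
  · exact absurd (h.trans h2) h1
  · simp [stepFun, h1, h2]

lemma integrable_stepFun_sub (y z : ℝ) : Integrable fun u => stepFun y u - stepFun z u := by
  rcases le_total y z with h | h
  · rw [stepFun_sub_eq h]
    exact (integrable_indicator_iff measurableSet_Ico).2 (integrableOn_const (by simp))
  · have e : (fun u => stepFun y u - stepFun z u) = fun u => -(stepFun z u - stepFun y u) := by
      funext u; ring
    rw [e]
    refine Integrable.neg ?_
    rw [stepFun_sub_eq h]
    exact (integrable_indicator_iff measurableSet_Ico).2 (integrableOn_const (by simp))

lemma wasserstein_stepFun (y z : ℝ) : ∫ u, |stepFun y u - stepFun z u| = |y - z| := by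
  have aux : ∀ y z : ℝ, y ≤ z → ∫ u, |stepFun y u - stepFun z u| = |y - z| := fun y z h => by
    have e : (fun u => |stepFun y u - stepFun z u|) = (Set.Ico y z).indicator fun _ => (1 : ℝ) := by
      rw [← stepFun_sub_eq h]
      funext u
      refine abs_of_nonneg ?_
      have := congrFun (stepFun_sub_eq h) u
      rw [this]
      exact Set.indicator_nonneg (fun _ _ => zero_le_one) _
    rw [e, integral_indicator_const _ measurableSet_Ico, abs_of_nonpos (by linarith)]
    simp [h]
  rcases le_total y z with h | h
  · exact aux y z h
  · rw [abs_sub_comm y z, ← aux z y h]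
    simp_rw [abs_sub_comm]

/-- Distribution functions at finite Wasserstein distance from a point mass. -/
def IntegrableDF (Q : ℝ → ℝ) : Prop := Integrable fun u => Q u - stepFun 0 u

lemma IntegrableDF.sub {Q R : ℝ → ℝ} (hQ : IntegrableDF Q) (hR : IntegrableDF R) :
    Integrable fun u => Q u - R u := by
  refine (Integrable.sub hQ hR).congr (ae_of_all _ fun u => ?_)
  simp

lemma integrableDF_stepFun (y : ℝ) : IntegrableDF (stepFun y) := integrable_stepFun_sub y 0

lemma IntegrableDF.sum {ι : Type*} {s : Finset ι} {w : ι → ℝ} {Q : ι → ℝ → ℝ}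
    (hw : ∑ i ∈ s, w i = 1) (hQ : ∀ i ∈ s, IntegrableDF (Q i)) :
    IntegrableDF fun u => ∑ i ∈ s, w i * Q i u := by
  have : (fun u => ∑ i ∈ s, w i * Q i u - stepFun 0 u)
      = fun u => ∑ i ∈ s, w i * (Q i u - stepFun 0 u) := by
    funext u
    simp_rw [mul_sub, Finset.sum_sub_distrib, ← Finset.sum_mul, hw, one_mul]
  unfold IntegrableDF
  rw [this]
  exact integrable_finsetSum _ fun i hi => (hQ i hi).const_mul _

lemma integrable_stepFun_left (μ : Measure ℝ) [IsProbabilityMeasure μ] (u : ℝ) :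
    Integrable (fun y => stepFun y u) μ :=
  (integrable_const (1 : ℝ)).mono' (measurable_stepFun_left u).aestronglyMeasurable
    (ae_of_all _ fun y => by
      rw [Real.norm_eq_abs, abs_of_nonneg (stepFun_nonneg y u)]; exact stepFun_le_one y u)

/-- The CDF minus the step at `0` is the `μ`-average of `stepFun y - stepFun 0`, whose `L¹` norm is
`|y|`; Fubini reduces the claim to the first moment. -/
lemma integrableDF_cdf {μ : Measure ℝ} [IsProbabilityMeasure μ]
    (hμ : Integrable (fun x : ℝ => x) μ) : IntegrableDF fun u => cdf μ u := by
  have hp : Integrable (fun p : ℝ × ℝ => stepFun p.1 p.2 - stepFun 0 p.2)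
      (μ.prod volume) := by
    rw [integrable_prod_iff]
    · refine ⟨ae_of_all _ fun y => integrable_stepFun_sub y 0, ?_⟩
      simp only [Real.norm_eq_abs, wasserstein_stepFun, sub_zero]
      exact hμ.abs
    · exact (measurable_stepFun.sub
        ((measurable_stepFun_right 0).comp measurable_snd)).aestronglyMeasurable
  have := hp.integral_prod_right
  refine this.congr (ae_of_all _ fun u => ?_)
  simp only
  rw [integral_sub, integral_stepFun]
  · simp
  · exact integrable_stepFun_left μ u
  · exact integrable_const _

lemma wasserstein_nonneg (Q R : ℝ → ℝ) : 0 ≤ wasserstein Q R :=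
  integral_nonneg fun _ => abs_nonneg _

lemma wasserstein_comm (Q R : ℝ → ℝ) : wasserstein Q R = wasserstein R Q := by
  unfold wasserstein
  simp_rw [abs_sub_comm]

lemma wasserstein_triangle {Q R S : ℝ → ℝ} (hQ : IntegrableDF Q) (hR : IntegrableDF R)
    (hS : IntegrableDF S) : wasserstein Q S ≤ wasserstein Q R + wasserstein R S := by
  unfold wasserstein
  rw [← integral_add (hQ.sub hR).abs (hR.sub hS).abs]
  exact integral_mono (hQ.sub hS).abs ((hQ.sub hR).abs.add (hR.sub hS).abs)
    fun u => abs_sub_le _ _ _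

lemma wasserstein_sum_le {ι : Type*} {s : Finset ι} {w : ι → ℝ} {Q R : ι → ℝ → ℝ}
    (hw : ∀ i ∈ s, 0 ≤ w i) (hQ : ∀ i ∈ s, IntegrableDF (Q i)) (hR : ∀ i ∈ s, IntegrableDF (R i)) :
    wasserstein (fun u => ∑ i ∈ s, w i * Q i u) (fun u => ∑ i ∈ s, w i * R i u)
      ≤ ∑ i ∈ s, w i * wasserstein (Q i) (R i) := by
  unfold wasserstein
  simp_rw [← integral_const_mul]
  rw [← integral_finsetSum _ fun i hi => (((hQ i hi).sub (hR i hi)).abs.const_mul _)]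
  have e : ∀ u, ∑ i ∈ s, w i * Q i u - ∑ i ∈ s, w i * R i u = ∑ i ∈ s, w i * (Q i u - R i u) :=
    fun u => by simp_rw [mul_sub, Finset.sum_sub_distrib]
  refine integral_mono ?_ (integrable_finsetSum _ fun i hi =>
    (((hQ i hi).sub (hR i hi)).abs.const_mul _)) fun u => ?_
  · simp_rw [e]
    exact (integrable_finsetSum _ fun i hi => (((hQ i hi).sub (hR i hi)).const_mul _)).abs
  · simp only [e]
    refine (Finset.abs_sum_le_sum_abs _ _).trans (Finset.sum_le_sum fun i hi => ?_)
    rw [abs_mul, abs_of_nonneg (hw i hi)]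

/-! ### The empirical distribution function of a sample -/

/-- The empirical distribution function of the sample `x`. -/
noncomputable def sampleCDF {n : ℕ} (x : Fin n → ℝ) (u : ℝ) : ℝ :=
  ∑ j, (n : ℝ)⁻¹ * stepFun (x j) u

lemma integrableDF_sampleCDF {n : ℕ} (hn : 0 < n) (x : Fin n → ℝ) :
    IntegrableDF (sampleCDF x) :=
  IntegrableDF.sum (by simp [hn.ne']) fun _ _ => integrableDF_stepFun _

section Sample

variable {μ : Measure ℝ} [IsProbabilityMeasure μ]

lemma wasserstein_sampleCDF_lipschitz (hμ : Integrable (fun x : ℝ => x) μ) {n : ℕ} (hn : 0 < n)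
    (x y : Fin n → ℝ) :
    |wasserstein (sampleCDF x) (fun u => cdf μ u) - wasserstein (sampleCDF y) (fun u => cdf μ u)|
      ≤ (n : ℝ)⁻¹ * ∑ i, |x i - y i| := by
  have h : ∀ x y : Fin n → ℝ,
      wasserstein (sampleCDF x) (sampleCDF y) ≤ (n : ℝ)⁻¹ * ∑ i, |x i - y i| := fun x y => by
    refine (wasserstein_sum_le (fun _ _ => by positivity) (fun _ _ => integrableDF_stepFun _)
      fun _ _ => integrableDF_stepFun _).trans_eq ?_
    simp_rw [wasserstein, wasserstein_stepFun, Finset.mul_sum]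
  have h1 := wasserstein_triangle (integrableDF_sampleCDF hn x) (integrableDF_sampleCDF hn y)
    (integrableDF_cdf hμ)
  have h2 := wasserstein_triangle (integrableDF_sampleCDF hn y) (integrableDF_sampleCDF hn x)
    (integrableDF_cdf hμ)
  have h3 := h x y
  rw [wasserstein_comm (sampleCDF y) (sampleCDF x)] at h2
  rw [abs_le]
  constructor <;> linarith

/-- On each side of the mean one factor is a sub-Gaussian tail and the other is at most `1`. -/
lemma cdf_mul_one_sub_le (hμ : HasSubgaussianMGF (fun x => x - ∫ y, y ∂μ) 1 μ) (u : ℝ) :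
    cdf μ u * (1 - cdf μ u) ≤ Real.exp (-(u - ∫ y, y ∂μ) ^ 2 / 2) := by
  have h0 := cdf_nonneg μ u
  have h1 := cdf_le_one μ u
  rcases le_total u (∫ y, y ∂μ) with h | h
  · have := hμ.neg.measure_ge_le (ε := (∫ y, y ∂μ) - u) (by linarith)
    have h2 : cdf μ u ≤ Real.exp (-(u - ∫ y, y ∂μ) ^ 2 / 2) := by
      rw [cdf_eq_real]
      refine (measureReal_mono ?_ (by finiteness)).trans (this.trans_eq ?_)
      · intro x hx
        simp only [Set.mem_Iic, Pi.neg_apply, Set.mem_ofPred_eq] at hx ⊢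
        linarith
      · congr 1; simp; ring
    nlinarith
  · have := hμ.measure_ge_le (ε := u - (∫ y, y ∂μ)) (by linarith)
    have h2 : 1 - cdf μ u ≤ Real.exp (-(u - ∫ y, y ∂μ) ^ 2 / 2) := by
      rw [cdf_eq_real, ← probReal_compl_eq_one_sub measurableSet_Iic]
      refine (measureReal_mono ?_ (by finiteness)).trans (this.trans_eq ?_)
      · intro x hx
        simp only [Set.mem_compl_iff, Set.mem_Iic, not_le, Set.mem_ofPred_eq] at hx ⊢
        linarith
      · congr 1; simp
    nlinarith

/-- The first absolute moment is at most the standard deviation of an average of `n` Bernoulli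
variables with parameter `cdf μ u`; the square root halves the Gaussian exponent. -/
lemma integral_abs_sampleCDF_sub_le
    (hμ : HasSubgaussianMGF (fun x => x - ∫ y, y ∂μ) 1 μ) {n : ℕ} (hn : 0 < n) (u : ℝ) :
    ∫ x, |sampleCDF x u - cdf μ u| ∂(Measure.pi fun _ : Fin n => μ)
      ≤ (√n)⁻¹ * Real.exp (-(u - ∫ y, y ∂μ) ^ 2 / 4) := by
  have hn' : (0 : ℝ) < n := by exact_mod_cast hn
  set P := Measure.pi fun _ : Fin n => μ
  have hmem : MemLp (fun y => (n : ℝ)⁻¹ * stepFun y u) 2 μ := by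
    refine MemLp.const_mul ?_ _
    exact MemLp.of_bound (measurable_stepFun_left u).aestronglyMeasurable 1 (ae_of_all _ fun y => by
      rw [Real.norm_eq_abs, abs_of_nonneg (stepFun_nonneg y u)]; exact stepFun_le_one y u)
  have hX : MemLp (fun x : Fin n → ℝ => sampleCDF x u) 2 P :=
    memLp_finsetSum _ fun i _ => hmem.comp_measurePreserving (measurePreserving_eval _ i)
  have hmean : ∫ x, sampleCDF x u ∂P = cdf μ u := by
    unfold sampleCDF
    rw [integral_finsetSum]
    · have : ∀ i : Fin n, ∫ x : Fin n → ℝ, (n : ℝ)⁻¹ * stepFun (x i) u ∂P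
          = (n : ℝ)⁻¹ * cdf μ u := fun i => by
        rw [integral_const_mul, ← integral_stepFun]
        congr 1
        exact (integral_map (measurable_pi_apply i).aemeasurable
          (measurable_stepFun_left u).aestronglyMeasurable).symm.trans
          (by rw [(measurePreserving_eval (fun _ : Fin n => μ) i).map_eq])
      simp_rw [this]
      simp [hn'.ne']
    · exact fun i _ => (hmem.comp_measurePreserving
        (measurePreserving_eval (fun _ : Fin n => μ) i)).integrable (by norm_num)
  have hvar : Var[fun x : Fin n → ℝ => sampleCDF x u; P] ≤ (n : ℝ)⁻¹ * (cdf μ u * (1 - cdf μ u)) := by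
    have e : (fun x : Fin n → ℝ => sampleCDF x u)
        = ∑ i : Fin n, fun x : Fin n → ℝ => (n : ℝ)⁻¹ * stepFun (x i) u := by
      funext x; simp [sampleCDF]
    have e2 := variance_sum_pi (μ := fun _ : Fin n => μ)
      (X := fun _ y => (n : ℝ)⁻¹ * stepFun y u) fun _ => hmem
    rw [e, e2, variance_const_mul]
    have h1 := variance_le_sub_mul_sub (μ := μ) (a := 0) (b := 1) (X := fun y => stepFun y u)
      (ae_of_all _ fun y => ⟨stepFun_nonneg y u, stepFun_le_one y u⟩)
      (measurable_stepFun_left u).aemeasurable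
    rw [integral_stepFun, sub_zero] at h1
    simp only [Finset.sum_const, Finset.card_univ, Fintype.card_fin, nsmul_eq_mul]
    calc (n : ℝ) * ((n : ℝ)⁻¹ ^ 2 * Var[fun y => stepFun y u; μ])
        = (n : ℝ)⁻¹ * Var[fun y => stepFun y u; μ] := by field_simp
      _ ≤ _ := by
        rw [mul_comm (cdf μ u)]
        gcongr
  have hY : MemLp (fun x : Fin n → ℝ => |sampleCDF x u - cdf μ u|) 2 P :=
    (hX.sub (memLp_const (cdf μ u))).abs
  have hnn := variance_nonneg (fun x : Fin n → ℝ => |sampleCDF x u - cdf μ u|) P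
  rw [variance_eq_sub hY] at hnn
  rw [variance_eq_integral hX.aestronglyMeasurable.aemeasurable, hmean] at hvar
  simp only [Pi.pow_apply, sq_abs] at hnn
  have hsq : (∫ x, |sampleCDF x u - cdf μ u| ∂P) ^ 2
      ≤ ((√n)⁻¹ * Real.exp (-(u - ∫ y, y ∂μ) ^ 2 / 4)) ^ 2 := by
    calc _ ≤ (n : ℝ)⁻¹ * (cdf μ u * (1 - cdf μ u)) := by linarith
      _ ≤ (n : ℝ)⁻¹ * Real.exp (-(u - ∫ y, y ∂μ) ^ 2 / 2) := by
        gcongr; exact cdf_mul_one_sub_le hμ u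
      _ = _ := by
        rw [mul_pow, inv_pow, Real.sq_sqrt hn'.le, ← Real.exp_nat_mul]
        congr 2
        push_cast
        ring
  exact (pow_le_pow_iff_left₀ (integral_nonneg fun _ => abs_nonneg _) (by positivity)
    two_ne_zero).1 hsq

/-- The expected Wasserstein distance of the empirical distribution of a sub-Gaussian sample. -/
lemma integral_wasserstein_sampleCDF_le
    (hμ : HasSubgaussianMGF (fun x => x - ∫ y, y ∂μ) 1 μ) {n : ℕ} (hn : 0 < n) :
    ∫ x, wasserstein (sampleCDF x) (fun u => cdf μ u) ∂(Measure.pi fun _ : Fin n => μ)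
      ≤ 4 / √n := by
  have hn' : (0 : ℝ) < n := by exact_mod_cast hn
  have hi := integrable_id_of_subgaussian hμ
  have hmeas : Measurable fun p : (Fin n → ℝ) × ℝ => sampleCDF p.1 p.2 - cdf μ p.2 := by
    refine Measurable.sub ?_ ((monotone_cdf μ).measurable.comp measurable_snd)
    unfold sampleCDF
    refine Finset.measurable_fun_sum _ fun j _ => Measurable.const_mul ?_ _
    have h : Measurable fun p : (Fin n → ℝ) × ℝ => (p.1 j, p.2) := by fun_prop
    exact measurable_stepFun.comp h
  have hint : Integrable (fun p : (Fin n → ℝ) × ℝ => |sampleCDF p.1 p.2 - cdf μ p.2|)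
      ((Measure.pi fun _ : Fin n => μ).prod volume) := by
    refine Integrable.abs ?_
    rw [integrable_prod_iff hmeas.aestronglyMeasurable]
    exact ⟨ae_of_all _ fun x => (integrableDF_sampleCDF hn x).sub (integrableDF_cdf hi),
      integrable_of_l1_lipschitz hμ (wasserstein_sampleCDF_lipschitz hi hn)⟩
  unfold wasserstein
  rw [integral_integral_swap hint]
  have gi : Integrable (fun u : ℝ => Real.exp (-(u - ∫ y, y ∂μ) ^ 2 / 4)) := by
    have := (integrable_exp_neg_mul_sq (b := 1 / 4) (by norm_num)).comp_sub_right (∫ y, y ∂μ)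
    refine this.congr (ae_of_all _ fun u => ?_)
    simp only
    ring_nf
  -- The integral equals `√(4π)`, and `π ≤ 4`.
  have gv : ∫ u : ℝ, Real.exp (-(u - ∫ y, y ∂μ) ^ 2 / 4) ≤ 4 := by
    have e := integral_gaussian (1 / 4)
    rw [← integral_sub_right_eq_self _ (∫ y, y ∂μ)] at e
    have : (fun u : ℝ => Real.exp (-(u - ∫ y, y ∂μ) ^ 2 / 4))
        = fun u => Real.exp (-(1 / 4) * (u - ∫ y, y ∂μ) ^ 2) := by
      funext u; ring_nf
    rw [this, e, Real.sqrt_le_left (by norm_num)]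
    linarith [Real.pi_le_four]
  refine (integral_mono hint.integral_prod_right (gi.const_mul (√n)⁻¹)
    (integral_abs_sampleCDF_sub_le hμ hn)).trans ?_
  rw [integral_const_mul, div_eq_inv_mul]
  gcongr

/-- Deviation of the Wasserstein distance between the empirical and the true distribution of a
sub-Gaussian sample. -/
lemma tail_wasserstein_sampleCDF_le
    (hμ : HasSubgaussianMGF (fun x => x - ∫ y, y ∂μ) 1 μ) {n : ℕ} (hn : 0 < n) {t l : ℝ}
    (hl : 0 ≤ l) (ht : 4 + 2 * √l ≤ √n * t) :
    (Measure.pi fun _ : Fin n => μ).real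
        {x | t ≤ wasserstein (sampleCDF x) (fun u => cdf μ u)} ≤ Real.exp (-l) := by
  have hn' : (0 : ℝ) < √n := Real.sqrt_pos.2 (by exact_mod_cast hn)
  -- The mean uses up `4/√n` of the threshold. The remaining deviation `s = 2√l/√n` is chosen so
  -- that `n s²/4 = l`.
  have hs : 2 * √l / √n ≤ t - 4 / √n := by
    rw [div_le_iff₀ hn', sub_mul, div_mul_cancel₀ _ hn'.ne']
    linarith
  have h := tail_le_of_l1_lipschitz hμ hn
    (wasserstein_sampleCDF_lipschitz (integrable_id_of_subgaussian hμ) hn)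
    (s := 2 * √l / √n) (by positivity)
  refine (measureReal_mono ?_ (by finiteness)).trans (h.trans_eq ?_)
  · intro x hx
    have := integral_wasserstein_sampleCDF_le hμ hn
    simp only [Set.mem_ofPred_eq] at hx ⊢
    linarith
  · rw [div_pow, mul_pow, Real.sq_sqrt hl, Real.sq_sqrt (Nat.cast_nonneg n)]
    congr 1
    have : (n : ℝ) ≠ 0 := by exact_mod_cast hn.ne'
    field_simp
    ring

end Sample

/-! ### Selection counts and the commit rule -/

section PullCount

variable {K : ℕ}

lemma pullCount_succ (A : ℕ → Fin K) (t : ℕ) (i : Fin K) :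
    pullCount A (t + 1) i = pullCount A t i + if A t = i then 1 else 0 := by
  unfold pullCount
  rw [Finset.range_add_one, Finset.filter_insert]
  split_ifs with h
  · rw [Finset.card_insert_of_notMem (by simp)]
  · simp

lemma pullCount_mono (A : ℕ → Fin K) (i : Fin K) : Monotone fun t => pullCount A t i :=
  monotone_nat_of_le_succ fun t => by rw [pullCount_succ]; omega

lemma sum_pullCount (A : ℕ → Fin K) (t : ℕ) : ∑ i, pullCount A t i = t := by
  induction t with
  | zero => simp [pullCount]
  | succ t ih => simp [pullCount_succ, Finset.sum_add_distrib, ih]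

/-- The empirical distribution function only depends on the rewards of the first selections. -/
lemma empiricalCDF_eq_sampleCDF {A : ℕ → Fin K} {x : Fin K → ℕ → ℝ} {t m : ℕ} {i : Fin K}
    (h : pullCount A t i = m) :
    empiricalCDF A x t i = sampleCDF fun j : Fin m => x i j := by
  subst h
  funext y
  -- A selection of arm `i` in round `t` reveals the reward with index `pullCount A t i`, exactly
  -- the next one in its list, whatever the order of exploration.
  have key : ∀ t, ((Finset.range t).filter fun s => A s = i ∧ reward A x s ≤ y).card
      = ((Finset.range (pullCount A t i)).filter fun j => x i j ≤ y).card := fun t => by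
    induction t with
    | zero => simp [pullCount]
    | succ t ih =>
      rw [Finset.range_add_one, Finset.filter_insert, pullCount_succ]
      by_cases h1 : A t = i
      · rw [if_pos h1, Finset.range_add_one, Finset.filter_insert]
        have hr : reward A x t = x i (pullCount A t i) := by rw [reward, h1]
        by_cases h2 : x i (pullCount A t i) ≤ y
        · rw [if_pos ⟨h1, hr ▸ h2⟩, if_pos h2, Finset.card_insert_of_notMem (by simp),
            Finset.card_insert_of_notMem (by simp), ih]
        · rw [if_neg (fun h => h2 (hr ▸ h.2)), if_neg h2, ih]
      · rw [if_neg (fun h => h1 h.1), if_neg h1, add_zero, ih]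
  unfold empiricalCDF sampleCDF stepFun
  rw [key, ← Finset.mul_sum, Fin.sum_univ_eq_sum_range (fun j => if x i j ≤ y then (1 : ℝ) else 0),
    Finset.sum_boole, div_eq_inv_mul]

variable {T m t₀ : ℕ} {a : Fin K → ℝ} {A : ℕ → Fin K}

/-- During the commit phase an arm other than the last is selected only below its quota, so only
exploration can push it above. -/
lemma pullCount_le_of_commitRule (h0 : ∀ i, pullCount A t₀ i = m)
    (hc : ∀ t, t₀ ≤ t → t < T → CommitRule T a A t) {i : Fin K} (hi : i.val + 1 < K) (ht : t₀ ≤ T) :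
    pullCount A T i ≤ max m ⌊(T : ℝ) * a i⌋₊ := by
  have : ∀ t, t₀ ≤ t → t ≤ T → pullCount A t i ≤ max m ⌊(T : ℝ) * a i⌋₊ := by
    intro t ht0
    induction t, ht0 using Nat.le_induction with
    | base => intro _; rw [h0]; exact le_max_left _ _
    | succ t ht0 ih =>
      intro htT
      rw [pullCount_succ]
      split_ifs with h
      · have := (hc t ht0 (by omega)).2 (h ▸ hi)
        rw [h] at this
        exact le_max_of_le_right this
      · exact ih (by omega)
  exact this T ht le_rfl

/-- The last arm is selected only once every other quota is met, and met quotas stay met because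
counts never decrease. -/
lemma pullCount_last_of_commitRule (h0 : ∀ i, pullCount A t₀ i = m)
    (hc : ∀ t, t₀ ≤ t → t < T → CommitRule T a A t) {l : Fin K} (hl : l.val + 1 = K)
    (ht : t₀ ≤ T) :
    pullCount A T l ≤ m ∨ ∀ i : Fin K, i.val + 1 < K → ⌊(T : ℝ) * a i⌋₊ ≤ pullCount A T i := by
  have : ∀ t, t₀ ≤ t → t ≤ T →
      (pullCount A t l ≤ m ∨ ∀ i : Fin K, i.val + 1 < K → ⌊(T : ℝ) * a i⌋₊ ≤ pullCount A t i) := by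
    intro t ht0
    induction t, ht0 using Nat.le_induction with
    | base => intro _; rw [h0]; exact Or.inl le_rfl
    | succ t ht0 ih =>
      intro htT
      by_cases h : A t = l
      · right
        intro i hi
        refine le_trans ?_ (pullCount_mono A i (Nat.le_succ t))
        by_contra hlt
        have := (hc t ht0 (by omega)).1 i hi (not_le.1 hlt)
        rw [h, Fin.le_def] at this
        omega
      · rcases ih (by omega) with h1 | h1
        · left
          rwa [pullCount_succ, if_neg h, add_zero]
        · right
          exact fun i hi => (h1 i hi).trans (pullCount_mono A i (Nat.le_succ t))
  exact this T ht le_rfl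

/-- After the commit phase, the fractions of selections are close to the committed coefficients. -/
lemma sum_abs_pullCount_div_sub_le (hK : 2 ≤ K) (hT : 0 < T) (ha : a ∈ stdSimplex ℝ (Fin K))
    (h0 : ∀ i, pullCount A t₀ i = m) (hc : ∀ t, t₀ ≤ t → t < T → CommitRule T a A t)
    (ht : t₀ ≤ T) :
    ∑ i, |a i - (pullCount A T i : ℝ) / T| ≤ 2 * (K * m + K) / T := by
  have hT' : (0 : ℝ) < T := by exact_mod_cast hT
  have hm : (0 : ℝ) ≤ m := m.cast_nonneg
  set z : Fin K → ℝ := fun i => (pullCount A T i : ℝ) - T * a i with hz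
  have hsum : ∑ i, z i = 0 := by
    simp only [hz, Finset.sum_sub_distrib, ← Finset.mul_sum, ha.2]
    have := sum_pullCount A T
    rw [← Nat.cast_sum, this]
    ring
  let l : Fin K := ⟨K - 1, by omega⟩
  have hl : l.val + 1 = K := by simp only [l]; omega
  have hne : ∀ i : Fin K, i ≠ l → i.val + 1 < K := fun i hi => by
    have : i.val ≠ l.val := fun h => hi (Fin.ext h)
    omega
  have hTa : ∀ i, 0 ≤ (T : ℝ) * a i := fun i => mul_nonneg hT'.le (ha.1 i)
  -- Only upper excesses need a bound, since the `z i` sum to `0` and hence `∑ |z i|` is twice the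
  -- sum of the positive parts. For the last arm with all quotas met, its excess is the total
  -- deficit of the others, each at most `1` by the floor.
  have hpos : ∀ i : Fin K, max (z i) 0 ≤ m + if i = l then (K : ℝ) else 0 := by
    intro i
    by_cases hi : i = l
    · subst hi
      rw [if_pos rfl]
      refine max_le ?_ (by positivity)
      rcases pullCount_last_of_commitRule h0 hc hl ht with h | h
      · have h' : (pullCount A T l : ℝ) ≤ m := by exact_mod_cast h
        have := hTa l
        simp only [hz]
        have : (0 : ℝ) ≤ K := K.cast_nonneg
        linarith
      · have h1 : ∑ i ∈ Finset.univ.erase l, -z i ≤ ∑ i ∈ Finset.univ.erase l, (1 : ℝ) := by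
          refine Finset.sum_le_sum fun i hi => ?_
          have h2 : ((⌊(T : ℝ) * a i⌋₊ : ℕ) : ℝ) ≤ pullCount A T i := by
            exact_mod_cast h i (hne i (Finset.ne_of_mem_erase hi))
          have h3 := Nat.lt_floor_add_one ((T : ℝ) * a i)
          simp only [hz]
          linarith
        rw [← Finset.add_sum_erase _ _ (Finset.mem_univ l)] at hsum
        rw [Finset.sum_neg_distrib] at h1
        have h4 : ∑ i ∈ Finset.univ.erase l, (1 : ℝ) ≤ K := by
          simp
        linarith
    · rw [if_neg hi, add_zero]
      refine max_le ?_ hm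
      have h1 := pullCount_le_of_commitRule h0 hc (hne i hi) ht
      have h2 : (pullCount A T i : ℝ) ≤ max (m : ℝ) ⌊(T : ℝ) * a i⌋₊ := by exact_mod_cast h1
      have h3 := Nat.floor_le (hTa i)
      have h4 := hTa i
      simp only [hz]
      rcases le_max_iff.1 h2 with h | h <;> linarith
  have habs : ∑ i, |z i| ≤ 2 * (K * m + K) := by
    have e : ∀ i, |z i| = 2 * max (z i) 0 - z i := fun i => by
      rcases le_total (z i) 0 with h | h
      · rw [abs_of_nonpos h, max_eq_right h]; ring
      · rw [abs_of_nonneg h, max_eq_left h]; ring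
    simp_rw [e, Finset.sum_sub_distrib, hsum, ← Finset.mul_sum]
    have := Finset.sum_le_sum fun i (_ : i ∈ Finset.univ) => hpos i
    simp only [Finset.sum_add_distrib, Finset.sum_const, Finset.card_univ, Fintype.card_fin,
      nsmul_eq_mul, Finset.sum_ite_eq', Finset.mem_univ, if_true] at this
    linarith
  have e : ∀ i, |a i - (pullCount A T i : ℝ) / T| = |z i| / T := fun i => by
    rw [abs_sub_comm, ← abs_of_pos hT', ← abs_div, abs_of_pos hT']
    congr 1
    simp only [hz]
    field_simp
  simp_rw [e, ← Finset.sum_div]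
  gcongr

lemma pullCount_div_mem_stdSimplex (hT : 0 < T) :
    (fun i => (pullCount A T i : ℝ) / T) ∈ stdSimplex ℝ (Fin K) := by
  have hT' : (0 : ℝ) < T := by exact_mod_cast hT
  refine ⟨fun i => by positivity, ?_⟩
  have := sum_pullCount A T
  rw [← Finset.sum_div, ← Nat.cast_sum, this, div_self hT'.ne']

end PullCount

/-! ### Mixtures of the arms -/

section Instance

variable {K : ℕ} {q r LH LMH B Wmax : ℝ} {h : ℝ → ℝ} {S : Set ℝ} {F : Fin K → Measure ℝ}
  {αs : Fin K → ℝ}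

lemma mix_eq_sum_smul (Q : Fin K → ℝ → ℝ) (α : Fin K → ℝ) : mix Q α = ∑ i, α i • Q i := by
  funext x
  simp [mix]

lemma mix_mem {Ξ : Set (ℝ → ℝ)} (hΞ : Convex ℝ Ξ) {Q : Fin K → ℝ → ℝ} (hQ : ∀ i, Q i ∈ Ξ)
    {α : Fin K → ℝ} (hα : α ∈ stdSimplex ℝ (Fin K)) : mix Q α ∈ Ξ := by
  rw [mix_eq_sum_smul]
  exact hΞ.sum_mem (fun i _ => hα.1 i) hα.2 fun i _ => hQ i

lemma armCDF_mem_convexHull (i : Fin K) : armCDF F i ∈ convexHull ℝ (Set.range (armCDF F)) :=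
  subset_convexHull ℝ _ ⟨i, rfl⟩

lemma armCDF_mem_sampleHull (i : Fin K) : armCDF F i ∈ sampleHull S F :=
  subset_convexHull ℝ _ (Or.inl ⟨i, rfl⟩)

lemma sampleCDF_mem_sampleHull {n : ℕ} (hn : 0 < n) {x : Fin n → ℝ} (hx : ∀ j, x j ∈ S) :
    sampleCDF x ∈ sampleHull S F := by
  have : sampleCDF x = ∑ j, (n : ℝ)⁻¹ • stepFun (x j) := by
    funext u
    simp [sampleCDF]
  rw [this]
  refine (convex_convexHull ℝ _).sum_mem (fun _ _ => by positivity) (by simp [hn.ne'])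
    fun j _ => subset_convexHull ℝ _ (Or.inr ⟨x j, hx j, (cdf_dirac_eq _).symm⟩)

lemma IntegrableDF.mix {Q : Fin K → ℝ → ℝ} (hQ : ∀ i, IntegrableDF (Q i)) {α : Fin K → ℝ}
    (hα : α ∈ stdSimplex ℝ (Fin K)) : IntegrableDF (mix Q α) :=
  IntegrableDF.sum hα.2 fun i _ => hQ i

lemma StandingAssumptions.integrableDF_armCDF
    (sa : StandingAssumptions q r LH LMH B Wmax h S F αs) (i : Fin K) :
    IntegrableDF (armCDF F i) := by
  have := sa.prob i
  exact integrableDF_cdf (integrable_id_of_subgaussian (sa.subGaussian i))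

/-- The constant is crude, but it shows that the set defining `wassersteinRatio` is bounded above,
so that its `sSup` is a genuine supremum and not the default value `0`. -/
lemma wasserstein_mix_le_sum_mul (hF : ∀ i, IntegrableDF (armCDF F i)) {α α' : Fin K → ℝ}
    (hα : α ∈ stdSimplex ℝ (Fin K)) (hα' : α' ∈ stdSimplex ℝ (Fin K)) :
    wasserstein (mix (armCDF F) α) (mix (armCDF F) α')
      ≤ (∑ j, wasserstein (armCDF F j) (stepFun 0)) * ∑ i, |α i - α' i| := by
  have e : ∀ u, mix (armCDF F) α u - mix (armCDF F) α' u
      = ∑ i, (α i - α' i) * (armCDF F i u - stepFun 0 u) := fun u => by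
    simp only [mix, mul_sub, sub_mul, Finset.sum_sub_distrib, ← Finset.sum_mul, hα.2, hα'.2]
    ring
  have hi : ∀ i ∈ Finset.univ, Integrable fun u => |α i - α' i| * |armCDF F i u - stepFun 0 u| :=
    fun i _ => (((hF i).sub (integrableDF_stepFun 0)).abs.const_mul _)
  have h1 : wasserstein (mix (armCDF F) α) (mix (armCDF F) α')
      ≤ ∑ i, |α i - α' i| * wasserstein (armCDF F i) (stepFun 0) := by
    unfold wasserstein
    simp_rw [← integral_const_mul]
    rw [← integral_finsetSum _ hi]
    refine integral_mono ((IntegrableDF.mix hF hα).sub (IntegrableDF.mix hF hα')).abs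
      (integrable_finsetSum _ hi) fun u => ?_
    simp only [e]
    refine (Finset.abs_sum_le_sum_abs _ _).trans_eq (Finset.sum_congr rfl fun i _ => abs_mul _ _)
  refine h1.trans ?_
  rw [mul_comm, Finset.sum_mul]
  refine Finset.sum_le_sum fun i _ => mul_le_mul_of_nonneg_left ?_ (abs_nonneg _)
  exact Finset.single_le_sum (f := fun j => wasserstein (armCDF F j) (stepFun 0))
    (fun j _ => wasserstein_nonneg _ _) (Finset.mem_univ i)

lemma wassersteinRatio_nonneg (F : Fin K → Measure ℝ) : 0 ≤ wassersteinRatio F := by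
  refine Real.sSup_nonneg ?_
  rintro w ⟨α, _, α', _, _, rfl⟩
  exact div_nonneg (wasserstein_nonneg _ _) (Finset.sum_nonneg fun _ _ => abs_nonneg _)

lemma StandingAssumptions.wasserstein_mix_le
    (sa : StandingAssumptions q r LH LMH B Wmax h S F αs) {α α' : Fin K → ℝ}
    (hα : α ∈ stdSimplex ℝ (Fin K)) (hα' : α' ∈ stdSimplex ℝ (Fin K)) :
    wasserstein (mix (armCDF F) α) (mix (armCDF F) α') ≤ Wmax * ∑ i, |α i - α' i| := by
  by_cases hne : α = α'
  · subst hne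
    simp [wasserstein]
  have hpos : 0 < ∑ i, |α i - α' i| := by
    refine lt_of_le_of_ne (Finset.sum_nonneg fun _ _ => abs_nonneg _) fun h0 => hne ?_
    funext i
    have := (Finset.sum_eq_zero_iff_of_nonneg fun i _ => abs_nonneg (α i - α' i)).1 h0.symm i
      (Finset.mem_univ i)
    exact sub_eq_zero.1 (abs_eq_zero.1 this)
  rw [← div_le_iff₀ hpos]
  refine le_trans ?_ sa.ratio_le
  refine le_csSup ?_ ⟨α, hα, α', hα', hne, rfl⟩
  refine ⟨∑ j, wasserstein (armCDF F j) (stepFun 0), ?_⟩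
  rintro w ⟨β, hβ, β', hβ', _, rfl⟩
  refine div_le_of_le_mul₀ (Finset.sum_nonneg fun _ _ => abs_nonneg _)
    (Finset.sum_nonneg fun _ _ => wasserstein_nonneg _ _) ?_
  exact wasserstein_mix_le_sum_mul sa.integrableDF_armCDF hβ hβ'

lemma StandingAssumptions.Wmax_nonneg
    (sa : StandingAssumptions q r LH LMH B Wmax h S F αs) : 0 ≤ Wmax :=
  (wassersteinRatio_nonneg F).trans sa.ratio_le

/-- The arms live on `[0, ∞)`, so the CDF of a mixture vanishes on the negative axis and the only
possibly negative integral is zero. -/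
lemma StandingAssumptions.mixValue_nonneg
    (sa : StandingAssumptions q r LH LMH B Wmax h S F αs) {α : Fin K → ℝ}
    (hα : α ∈ stdSimplex ℝ (Fin K)) : 0 ≤ mixValue h F α := by
  have hz : ∀ x ∈ Set.Iio (0 : ℝ), mix (armCDF F) α x = 0 := fun x hx => by
    refine Finset.sum_eq_zero fun i _ => ?_
    have := sa.prob i
    have h0 : (F i) (Set.Iic x) = 0 := by
      refine measure_mono_null (fun y hy => ?_) (ae_iff.1 (sa.mem i))
      intro hyS
      have hy0 : (0 : ℝ) ≤ y := sa.nonneg hyS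
      exact absurd (hy0.trans hy) (not_le.2 hx)
    rw [armCDF, cdf_eq_real, measureReal_def, h0]
    simp
  have h1 : ∫ x in Set.Iio (0 : ℝ), (h (1 - mix (armCDF F) α x) - h 1) = 0 := by
    rw [setIntegral_congr_fun (g := fun _ => (0 : ℝ)) measurableSet_Iio fun x hx => ?_]
    · simp
    · simp only [hz x hx, sub_zero, sub_self]
  unfold mixValue distortionRisk
  rw [h1, zero_add]
  refine integral_nonneg fun x => (sa.h_mem _ ⟨?_, ?_⟩).1
  · rw [sub_nonneg, ← hα.2]
    refine Finset.sum_le_sum fun i _ => ?_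
    exact mul_le_of_le_one_right (hα.1 i) (cdf_le_one _ _)
  · rw [sub_le_self_iff]
    exact Finset.sum_nonneg fun i _ => mul_nonneg (hα.1 i) (cdf_nonneg _ _)

/-! ### The discrete simplex -/

/-- Every point of the simplex is within `ℓ¹`-distance `2 K ε` of the discrete simplex. -/
lemma exists_discreteSimplex_near (hK : 2 ≤ K) {ε : ℝ} (hε : 0 < ε) {α : Fin K → ℝ}
    (hα : α ∈ stdSimplex ℝ (Fin K)) :
    ∃ b ∈ discreteSimplex K ε, ∑ i, |α i - b i| ≤ 2 * K * ε := by
  let l : Fin K := ⟨K - 1, by omega⟩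
  have hl : l.val + 1 = K := by simp only [l]; omega
  -- Every coordinate is rounded down to the grid, and the last one then absorbs what the others
  -- lost; it therefore only grows, and moves by the total loss of the others.
  let g : Fin K → ℝ := fun i => ε * ⌊α i / ε⌋₊
  have hg0 : ∀ i, 0 ≤ g i := fun i => by positivity
  have hg1 : ∀ i, g i ≤ α i := fun i => by
    have := Nat.floor_le (div_nonneg (hα.1 i) hε.le)
    rw [le_div_iff₀ hε] at this
    simp only [g]
    linarith
  have hg2 : ∀ i, α i ≤ g i + ε := fun i => by
    have := (Nat.lt_floor_add_one (α i / ε)).le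
    rw [div_le_iff₀ hε] at this
    simp only [g]
    linarith
  have hsumα : α l + ∑ i ∈ Finset.univ.erase l, α i = 1 := by
    rw [Finset.add_sum_erase _ _ (Finset.mem_univ l), hα.2]
  have hle : ∑ i ∈ Finset.univ.erase l, g i ≤ ∑ i ∈ Finset.univ.erase l, α i :=
    Finset.sum_le_sum fun i _ => hg1 i
  let b : Fin K → ℝ := Function.update g l (1 - ∑ i ∈ Finset.univ.erase l, g i)
  have hbl : b l = 1 - ∑ i ∈ Finset.univ.erase l, g i := Function.update_self ..
  have hbi : ∀ i, i ≠ l → b i = g i := fun i hi => Function.update_of_ne hi _ _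
  have hbs : ∑ i ∈ Finset.univ.erase l, b i = ∑ i ∈ Finset.univ.erase l, g i :=
    Finset.sum_congr rfl fun i hi => hbi i (Finset.ne_of_mem_erase hi)
  have hbl' : α l ≤ b l := by rw [hbl]; linarith
  refine ⟨b, ⟨⟨fun i => ?_, ?_⟩, fun i hi => ⟨⌊α i / ε⌋₊, hbi i ?_⟩⟩, ?_⟩
  · by_cases hi : i = l
    · rw [hi]; exact (hα.1 l).trans hbl'
    · rw [hbi i hi]; exact hg0 i
  · rw [← Finset.add_sum_erase _ _ (Finset.mem_univ l), hbs, hbl]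
    ring
  · rintro rfl
    omega
  · rw [← Finset.add_sum_erase _ _ (Finset.mem_univ l)]
    have h1 : ∑ i ∈ Finset.univ.erase l, |α i - b i| = ∑ i ∈ Finset.univ.erase l, (α i - g i) :=
      Finset.sum_congr rfl fun i hi => by
        rw [hbi i (Finset.ne_of_mem_erase hi), abs_of_nonneg (sub_nonneg.2 (hg1 i))]
    have h2 : ∑ i ∈ Finset.univ.erase l, (α i - g i) ≤ K * ε := by
      refine (Finset.sum_le_sum fun i _ => (sub_le_iff_le_add'.2 (hg2 i))).trans ?_
      rw [Finset.sum_const, nsmul_eq_mul]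
      gcongr
      simp
    have h3 : |α l - b l| = ∑ i ∈ Finset.univ.erase l, (α i - g i) := by
      rw [abs_of_nonpos (sub_nonpos.2 hbl'), hbl, Finset.sum_sub_distrib]
      linarith
    rw [h1, h3]
    linarith

/-- If the minimum gap is positive, then the discrete optimum exists and is isolated by the gap. -/
lemma exists_discrete_optimum {ε : ℝ} (hgap : 0 < minGap h F ε) :
    ∃ a' ∈ discreteSimplex K ε, (∀ b ∈ discreteSimplex K ε, mixValue h F b ≤ mixValue h F a') ∧
      (∀ a ∈ discreteSimplex K ε, a ≠ a' → minGap h F ε ≤ mixValue h F a' - mixValue h F a) ∧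
      ∃ a ∈ discreteSimplex K ε, a ≠ a' := by
  have hne : {d | ∃ a' ∈ discreteSimplex K ε,
      (∀ b ∈ discreteSimplex K ε, mixValue h F b ≤ mixValue h F a') ∧
      ∃ a ∈ discreteSimplex K ε, a ≠ a' ∧ d = mixValue h F a' - mixValue h F a}.Nonempty := by
    by_contra hcon
    rw [Set.not_nonempty_iff_eq_empty] at hcon
    -- The infimum of the empty set is `0` by convention, so positivity of the gap also provides a
    -- maximizer and a second grid point.
    rw [minGap, hcon, Real.sInf_empty] at hgap
    exact lt_irrefl _ hgap
  obtain ⟨d, a', ha', hmax, a, ha, hna, _⟩ := hne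
  refine ⟨a', ha', hmax, fun b hb hb' => csInf_le ⟨0, ?_⟩ ⟨a', ha', hmax, b, hb, hb', rfl⟩,
    a, ha, hna⟩
  rintro d ⟨c', _, hc', c, hc, _, rfl⟩
  exact sub_nonneg.2 (hc' c hc)

/-- A positive minimum gap forces a positive Hölder constant. -/
lemma StandingAssumptions.LH_pos (sa : StandingAssumptions q r LH LMH B Wmax h S F αs) {ε : ℝ}
    (hgap : 0 < minGap h F ε) : 0 < LH := by
  obtain ⟨a', ha', -, hgap', a, ha, hne⟩ := exists_discrete_optimum hgap
  by_contra hL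
  have h1 := sa.holder _ (mix_mem (convex_convexHull ℝ _) armCDF_mem_sampleHull ha'.1) _
    (mix_mem (convex_convexHull ℝ _) armCDF_mem_sampleHull ha.1)
  have h2 := hgap' a ha hne
  have h3 : LH * wasserstein (mix (armCDF F) a') (mix (armCDF F) a) ^ q ≤ 0 :=
    mul_nonpos_of_nonpos_of_nonneg (not_lt.1 hL) (Real.rpow_nonneg (wasserstein_nonneg _ _) _)
  change mixValue h F a' - mixValue h F a ≤ _ at h1
  linarith

/-- If the estimates `Q` of the arms are precise enough, then the maximizer of the empirical
riskmetric is the discrete optimum. -/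
lemma StandingAssumptions.selection_correct
    (sa : StandingAssumptions q r LH LMH B Wmax h S F αs) (hq : 0 < q) (hLH : 0 ≤ LH) {ε t Δ : ℝ}
    {Q : Fin K → ℝ → ℝ} (hQ : ∀ i, IntegrableDF (Q i)) (hQm : ∀ i, Q i ∈ sampleHull S F)
    (hW : ∀ i, wasserstein (Q i) (armCDF F i) ≤ t) (ht : LH * t ^ q < Δ / 2)
    {a' : Fin K → ℝ} (ha' : a' ∈ discreteSimplex K ε)
    (hgap : ∀ a ∈ discreteSimplex K ε, a ≠ a' → Δ ≤ mixValue h F a' - mixValue h F a)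
    {a : Fin K → ℝ} (ha : a ∈ discreteSimplex K ε)
    (hmax : ∀ b ∈ discreteSimplex K ε, distortionRisk h (mix Q b) ≤ distortionRisk h (mix Q a)) :
    a = a' := by
  by_contra hne
  -- Convexity gives the precision `t` for all mixtures simultaneously, without a union bound over
  -- the grid.
  have hw : ∀ b ∈ stdSimplex ℝ (Fin K), wasserstein (mix Q b) (mix (armCDF F) b) ≤ t :=
    fun b hb => by
      refine (wasserstein_sum_le (fun i _ => hb.1 i) (fun i _ => hQ i)
        fun i _ => sa.integrableDF_armCDF i).trans ?_
      calc ∑ i, b i * wasserstein (Q i) (armCDF F i) ≤ ∑ i, b i * t :=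
            Finset.sum_le_sum fun i _ => mul_le_mul_of_nonneg_left (hW i) (hb.1 i)
        _ = t := by rw [← Finset.sum_mul, hb.2, one_mul]
  have hbd : ∀ b ∈ stdSimplex ℝ (Fin K),
      LH * wasserstein (mix Q b) (mix (armCDF F) b) ^ q ≤ LH * t ^ q := fun b hb => by
    gcongr
    · exact wasserstein_nonneg _ _
    · exact hw b hb
  have mQ : ∀ b ∈ stdSimplex ℝ (Fin K), mix Q b ∈ sampleHull S F := fun b hb =>
    mix_mem (convex_convexHull ℝ _) hQm hb
  have mF : ∀ b ∈ stdSimplex ℝ (Fin K), mix (armCDF F) b ∈ sampleHull S F := fun b hb =>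
    mix_mem (convex_convexHull ℝ _) armCDF_mem_sampleHull hb
  -- Two Hölder errors, at `a` and at `a'`, each below `Δ/2`, cannot bridge a gap of `Δ`.
  have h1 := (sa.holder _ (mQ a ha.1) _ (mF a ha.1)).trans (hbd a ha.1)
  have h2 := sa.holder _ (mF a' ha'.1) _ (mQ a' ha'.1)
  rw [wasserstein_comm] at h2
  have h2' := h2.trans (hbd a' ha'.1)
  have h3 := hmax a' ha'
  have h4 := hgap a ha hne
  unfold mixValue at h4
  linarith

/-- The loss of the discrete optimum against the continuous one. -/
lemma StandingAssumptions.discretization_loss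
    (sa : StandingAssumptions q r LH LMH B Wmax h S F αs) (hr : 0 < r) (hLMH : 0 ≤ LMH) {ε : ℝ}
    (hε : 0 < ε) {a' : Fin K → ℝ}
    (hmax : ∀ b ∈ discreteSimplex K ε, mixValue h F b ≤ mixValue h F a') :
    mixValue h F αs - mixValue h F a' ≤ LMH * (Wmax * (2 * K * ε)) ^ r := by
  obtain ⟨b, hb, hd⟩ := exists_discreteSimplex_near sa.two_le hε sa.optimal.1
  have h1 := sa.mixtureHolder _ (mix_mem (convex_convexHull ℝ _) armCDF_mem_convexHull hb.1)
  have h2 := hmax b hb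
  have h3 : wasserstein (mix (armCDF F) αs) (mix (armCDF F) b) ≤ Wmax * (2 * K * ε) :=
    (sa.wasserstein_mix_le sa.optimal.1 hb.1).trans
      (mul_le_mul_of_nonneg_left hd sa.Wmax_nonneg)
  have h4 : LMH * wasserstein (mix (armCDF F) αs) (mix (armCDF F) b) ^ r
      ≤ LMH * (Wmax * (2 * K * ε)) ^ r := by
    gcongr
    exact wasserstein_nonneg _ _
  change mixValue h F αs - mixValue h F b ≤ _ at h1
  linarith

/-- The loss of a coefficient vector against a nearby one. -/
lemma StandingAssumptions.mixValue_sub_le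
    (sa : StandingAssumptions q r LH LMH B Wmax h S F αs) (hq : 0 < q) (hLH : 0 ≤ LH)
    {α α' : Fin K → ℝ} (hα : α ∈ stdSimplex ℝ (Fin K)) (hα' : α' ∈ stdSimplex ℝ (Fin K)) {d : ℝ}
    (hd : ∑ i, |α i - α' i| ≤ d) :
    mixValue h F α - mixValue h F α' ≤ LH * (Wmax * d) ^ q := by
  have h1 := sa.holder _ (mix_mem (convex_convexHull ℝ _) armCDF_mem_sampleHull hα) _
    (mix_mem (convex_convexHull ℝ _) armCDF_mem_sampleHull hα')
  have h3 : wasserstein (mix (armCDF F) α) (mix (armCDF F) α') ≤ Wmax * d :=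
    (sa.wasserstein_mix_le hα hα').trans (mul_le_mul_of_nonneg_left hd sa.Wmax_nonneg)
  refine h1.trans ?_
  gcongr
  exact wasserstein_nonneg _ _

end Instance

/-! ### The regret bound at a fixed level and horizon -/

section Regret

variable {K : ℕ} {q r LH LMH B Wmax : ℝ} {h : ℝ → ℝ} {S : Set ℝ} {F : Fin K → Measure ℝ}
  {αs : Fin K → ℝ} {Ω : Type*} [MeasurableSpace Ω] {P : Measure Ω}
  {X : Fin K → ℕ → Ω → ℝ}

lemma measurable_pullCount {A : ℕ → Ω → Fin K} (hA : ∀ t, Measurable (A t)) (T : ℕ) (i : Fin K) :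
    Measurable fun ω => pullCount (fun t => A t ω) T i := by
  unfold pullCount
  simp_rw [Finset.card_filter]
  exact Finset.measurable_fun_sum _ fun s _ =>
    Measurable.ite (hA s (measurableSet_singleton i)) measurable_const measurable_const

lemma IsRewardModel.map_sample_eq [IsProbabilityMeasure P] (hX : IsRewardModel P F X) (i : Fin K)
    (m : ℕ) :
    P.map (fun ω (j : Fin m) => X i j ω) = Measure.pi fun _ : Fin m => F i := by
  have hind : iIndepFun (fun j : Fin m => X i j) P :=
    hX.indep.precomp (g := fun j : Fin m => (i, (j : ℕ))) fun a b hab => by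
      simpa [Fin.ext_iff] using hab
  rw [(iIndepFun_iff_map_fun_eq_pi_map (f := fun j : Fin m => X i j)
    fun j => (hX.measurable i j).aemeasurable).1 hind]
  simp_rw [hX.law]

lemma StandingAssumptions.measurable_wasserstein_sample
    (sa : StandingAssumptions q r LH LMH B Wmax h S F αs) (i : Fin K) {m : ℕ} (hm : 0 < m) :
    Measurable fun x : Fin m → ℝ => wasserstein (sampleCDF x) (armCDF F i) := by
  have := sa.prob i
  exact (continuous_of_l1_lipschitz (wasserstein_sampleCDF_lipschitz
    (integrable_id_of_subgaussian (sa.subGaussian i)) hm)).measurable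

/-- The event that the empirical distribution of some arm is not precise. -/
def impreciseEvent (F : Fin K → Measure ℝ) (X : Fin K → ℕ → Ω → ℝ) (m : ℕ) (t : ℝ) : Set Ω :=
  ⋃ i, {ω | t ≤ wasserstein (sampleCDF fun j : Fin m => X i j ω) (armCDF F i)}

lemma measurableSet_impreciseEvent (sa : StandingAssumptions q r LH LMH B Wmax h S F αs)
    (hX : IsRewardModel P F X) {m : ℕ} (hm : 0 < m) (t : ℝ) :
    MeasurableSet (impreciseEvent F X m t) :=
  MeasurableSet.iUnion fun i => measurableSet_le measurable_const
    ((sa.measurable_wasserstein_sample i hm).comp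
      (measurable_pi_lambda _ fun j : Fin m => hX.measurable i j))

lemma measureReal_impreciseEvent_le [IsProbabilityMeasure P]
    (sa : StandingAssumptions q r LH LMH B Wmax h S F αs)
    (hX : IsRewardModel P F X) {m : ℕ} (hm : 0 < m) {t l : ℝ} (hl : 0 ≤ l)
    (ht : 4 + 2 * √l ≤ √m * t) : P.real (impreciseEvent F X m t) ≤ K * Real.exp (-l) := by
  refine (measureReal_iUnion_fintype_le _).trans ?_
  refine (Finset.sum_le_sum (g := fun _ => Real.exp (-l)) fun i _ => ?_).trans_eq (by simp)
  have := sa.prob i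
  have h1 := tail_wasserstein_sampleCDF_le (sa.subGaussian i) hm hl ht
  change (Measure.pi fun _ : Fin m => F i).real
    {x | t ≤ wasserstein (sampleCDF x) (armCDF F i)} ≤ _ at h1
  rw [← hX.map_sample_eq i m, map_measureReal_apply
    (measurable_pi_lambda _ fun j : Fin m => hX.measurable i j)
    (measurableSet_le measurable_const (sa.measurable_wasserstein_sample i hm))] at h1
  exact h1

lemma StandingAssumptions.regret_le [IsProbabilityMeasure P]
    (sa : StandingAssumptions q r LH LMH B Wmax h S F αs) (hq : 0 < q) (hr : 0 < r)
    (hLH : 0 ≤ LH) (hLMH : 0 ≤ LMH) {ε N : ℝ} (hε : 0 < ε) (hgap : 0 < minGap h F ε) {T m : ℕ}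
    (hT : 0 < T) (hm : 0 < m) (hmN : ⌈N / K⌉₊ = m) (hmT : K * m ≤ T) {t l : ℝ} (hl : 0 ≤ l)
    (ht : 4 + 2 * √l ≤ √m * t) (htΔ : LH * t ^ q < minGap h F ε / 2)
    (hX : IsRewardModel P F X) {A : ℕ → Ω → Fin K} (hA : ∀ t, Measurable (A t))
    (hfol : ∀ᵐ ω ∂P, FollowsRSETCM h ε N T (fun i n => X i n ω) (fun t => A t ω)) :
    regret P h F αs A T ≤ LMH * (Wmax * (2 * K * ε)) ^ r
      + LH * (Wmax * (2 * (K * m + K) / T)) ^ q + B * (K * Real.exp (-l)) := by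
  obtain ⟨a', ha', hmax, hgap', -⟩ := exists_discrete_optimum hgap
  set D := LMH * (Wmax * (2 * K * ε)) ^ r with hD
  set G := LH * (Wmax * (2 * (K * m + K) / T)) ^ q with hG
  have hW := sa.Wmax_nonneg
  have hD0 : 0 ≤ D := by positivity
  have hG0 : 0 ≤ G := by positivity
  have hB : mixValue h F αs ≤ B := sa.bounded _ sa.optimal.1
  have hB0 : 0 ≤ B := (sa.mixValue_nonneg sa.optimal.1).trans hB
  set V : Ω → ℝ := fun ω =>
    mixValue h F fun i => (pullCount (fun t => A t ω) T i : ℝ) / (T : ℝ) with hV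
  have hsimp : ∀ ω, (fun i => (pullCount (fun t => A t ω) T i : ℝ) / (T : ℝ))
      ∈ stdSimplex ℝ (Fin K) := fun ω => pullCount_div_mem_stdSimplex hT
  have hVm : Measurable V := by
    have h1 : Measurable fun ω => fun i => pullCount (fun t => A t ω) T i :=
      measurable_pi_lambda _ fun i => measurable_pullCount hA T i
    -- `V` is a function of the vector of counts, which takes values in a discrete space; no
    -- regularity of `h` is involved.
    exact (Measurable.of_discrete (f := fun p : Fin K → ℕ =>
      mixValue h F fun i => (p i : ℝ) / (T : ℝ))).comp h1
  have hVi : Integrable V P := (integrable_const B).mono' hVm.aestronglyMeasurable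
    (ae_of_all _ fun ω => by
      rw [Real.norm_eq_abs, abs_of_nonneg (sa.mixValue_nonneg (hsimp ω))]
      exact sa.bounded _ (hsimp ω))
  set Bad := impreciseEvent F X m t with hBad
  have hBadm : MeasurableSet Bad := measurableSet_impreciseEvent sa hX hm t
  have hXS : ∀ᵐ ω ∂P, ∀ i j, X i j ω ∈ S := by
    refine ae_all_iff.2 fun i => ae_all_iff.2 fun j => ?_
    have := sa.mem i
    rw [← hX.law i j] at this
    exact ae_of_ae_map (hX.measurable i j).aemeasurable this
  have hpt : ∀ᵐ ω ∂P, mixValue h F αs - D - G - Bad.indicator (fun _ => B) ω ≤ V ω := by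
    filter_upwards [hXS, hfol] with ω hS hf
    by_cases hω : ω ∈ Bad
    · rw [Set.indicator_of_mem hω]
      have := sa.mixValue_nonneg (hsimp ω)
      simp only [hV]
      linarith
    · rw [Set.indicator_of_notMem hω, sub_zero]
      obtain ⟨hexp, a, ha, hamax, hcom⟩ := hf
      rw [hmN] at hexp hamax hcom
      have hemp : empiricalCDF (fun t => A t ω) (fun i n => X i n ω) (K * m)
          = fun i => sampleCDF fun j : Fin m => X i j ω :=
        funext fun i => empiricalCDF_eq_sampleCDF (hexp i)
      rw [hemp] at hamax
      -- Off the bad event every empirical maximizer is the grid optimum, so the rule for breaking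
      -- ties is irrelevant.
      have haa : a = a' := sa.selection_correct hq hLH (t := t)
        (fun i => integrableDF_sampleCDF hm _)
        (fun i => sampleCDF_mem_sampleHull hm fun j => hS i j)
        (fun i => by
          by_contra hlt
          exact hω (Set.mem_iUnion.2 ⟨i, (not_le.1 hlt).le⟩)) htΔ ha' hgap' ha hamax
      subst haa
      have h1 := sa.discretization_loss hr hLMH hε hmax
      have h2 := sa.mixValue_sub_le hq hLH ha.1 (hsimp ω)
        (sum_abs_pullCount_div_sub_le sa.two_le hT ha.1 hexp hcom hmT)
      simp only [hV]
      linarith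
  have hint := integral_mono_ae (((integrable_const (mixValue h F αs - D - G)).sub
    ((integrable_const B).indicator hBadm))) hVi hpt
  rw [integral_sub' (integrable_const _) ((integrable_const B).indicator hBadm),
    integral_indicator_const _ hBadm] at hint
  simp only [integral_const, probReal_univ, smul_eq_mul, one_mul] at hint
  have hbad := mul_le_mul_of_nonneg_right (measureReal_impreciseEvent_le sa hX hm hl ht) hB0
  change mixValue h F αs - ∫ ω, V ω ∂P ≤ _
  linarith

end Regret

/-! ### The order of the exploration length and of the discretization level -/

section Asymptotics

variable {q r β L cgap c₁ : ℝ}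

/-- The quantity whose power is the order of the discretization level. -/
noncomputable def levelBase (q r β : ℝ) (K T : ℕ) : ℝ :=
  (K : ℝ) ^ (2 + 2 / q) * (T : ℝ) ^ (-gammaExp β r) * Real.log T

lemma levelOrder_eq (q r β : ℝ) (K T : ℕ) :
    levelOrder q r β K T = levelBase q r β K T ^ (q / (2 * β)) := rfl

lemma one_le_log_of_three_le {T : ℕ} (hT : 3 ≤ T) : 1 ≤ Real.log T := by
  have h3 : (3 : ℝ) ≤ T := by exact_mod_cast hT
  rw [Real.le_log_iff_exp_le (by linarith)]
  linarith [Real.exp_one_lt_three]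

lemma gammaExp_pos (hβ : 0 < β) (hr : 0 < r) : 0 < gammaExp β r := by
  unfold gammaExp; positivity

lemma gammaExp_lt_one (hβ : 0 < β) (hr : 0 < r) : gammaExp β r < 1 := by
  unfold gammaExp
  rw [div_lt_one (by positivity)]
  linarith

lemma levelBase_pos (q r β : ℝ) {K T : ℕ} (hK : 2 ≤ K) (hT : 3 ≤ T) :
    0 < levelBase q r β K T := by
  have := one_le_log_of_three_le hT
  have h1 : (0 : ℝ) < K := by exact_mod_cast (by omega : 0 < K)
  have h2 : (0 : ℝ) < T := by exact_mod_cast (by omega : 0 < T)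
  unfold levelBase
  positivity

lemma levelOrder_pos (q r β : ℝ) {K T : ℕ} (hK : 2 ≤ K) (hT : 3 ≤ T) :
    0 < levelOrder q r β K T :=
  Real.rpow_pos_of_pos (levelBase_pos q r β hK hT) _

lemma rpow_neg_gammaExp_le_levelBase (hq : 0 < q) {K T : ℕ} (hK : 2 ≤ K) (hT : 3 ≤ T) :
    (T : ℝ) ^ (-gammaExp β r) ≤ levelBase q r β K T := by
  have h0 := one_le_log_of_three_le hT
  have h1 : (1 : ℝ) ≤ K := by exact_mod_cast (by omega : 1 ≤ K)
  have h2 : (0 : ℝ) < T := by exact_mod_cast (by omega : 0 < T)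
  have h3 : 1 ≤ (K : ℝ) ^ (2 + 2 / q) := Real.one_le_rpow h1 (by positivity)
  have h4 : (0 : ℝ) < (T : ℝ) ^ (-gammaExp β r) := by positivity
  unfold levelBase
  calc (T : ℝ) ^ (-gammaExp β r) = 1 * (T : ℝ) ^ (-gammaExp β r) * 1 := by ring
    _ ≤ _ := by gcongr

/-- An admissible level bounds the number of arms. -/
lemma natCast_le_of_level_le_one (hq : 0 < q) (hβ : 0 < β) (hc₁ : 0 < c₁) {K T : ℕ} (hK : 2 ≤ K)
    (hT : 3 ≤ T) (h : c₁ * levelOrder q r β K T ≤ 1) :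
    (K : ℝ) ≤ c₁⁻¹ ^ (2 * β / q) * (T : ℝ) ^ gammaExp β r := by
  have h0 := one_le_log_of_three_le hT
  have h1 : (1 : ℝ) ≤ K := by exact_mod_cast (by omega : 1 ≤ K)
  have h2 : (0 : ℝ) < T := by exact_mod_cast (by omega : 0 < T)
  have hM := levelBase_pos q r β hK hT
  have h3 : levelBase q r β K T ≤ c₁⁻¹ ^ (2 * β / q) := by
    have e : levelBase q r β K T = levelOrder q r β K T ^ (2 * β / q) := by
      rw [levelOrder_eq, ← Real.rpow_mul hM.le]
      field_simp
      simp
    rw [e]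
    refine Real.rpow_le_rpow (Real.rpow_nonneg hM.le _) ?_ (by positivity)
    have hlev := levelOrder_pos q r β hK hT
    rw [le_inv_comm₀ hlev hc₁, ← one_div, le_div_iff₀ hlev]
    exact h
  have h4 : (K : ℝ) ≤ (K : ℝ) ^ (2 + 2 / q) := by
    refine (Real.rpow_one _).symm.le.trans (Real.rpow_le_rpow_of_exponent_le h1 ?_)
    have : 0 < 2 / q := by positivity
    linarith
  have h5 : (K : ℝ) * (T : ℝ) ^ (-gammaExp β r) ≤ levelBase q r β K T := by
    unfold levelBase
    calc (K : ℝ) * (T : ℝ) ^ (-gammaExp β r) = K * (T : ℝ) ^ (-gammaExp β r) * 1 := by ring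
      _ ≤ _ := by gcongr
  rw [Real.rpow_neg h2.le, ← div_eq_mul_inv, div_le_iff₀ (by positivity)] at h5
  exact h5.trans (by gcongr)

/-- The logarithmic term of the exploration length. -/
noncomputable def logTerm (K T : ℕ) (ε : ℝ) : ℝ :=
  Real.log (2 * K * (T : ℝ) ^ 2 * ((ε ^ (K - 1))⁻¹ + 1))

/-- The power `ε ^ (K - 1)` contributes at most `K * A * log T`. The `7` is `4 + 1 + 2`, from `log 4
≤ 4`, `log K ≤ K` and `log (T ^ 2)`, each absorbed into `K * log T`. -/
lemma logTerm_le {A : ℝ} {K T : ℕ} (hK : 2 ≤ K) (hT : 3 ≤ T) {ε : ℝ} (hε : 0 < ε)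
    (hε1 : ε ≤ 1) (hlog : -Real.log ε ≤ A * Real.log T) :
    logTerm K T ε ≤ (7 + A) * (K * Real.log T) := by
  have h0 := one_le_log_of_three_le hT
  have h1 : (1 : ℝ) ≤ K := by exact_mod_cast (by omega : 1 ≤ K)
  have h2 : (0 : ℝ) < T := by exact_mod_cast (by omega : 0 < T)
  have hp : 0 < ε ^ (K - 1) := by positivity
  have hp1 : 1 ≤ (ε ^ (K - 1))⁻¹ := (one_le_inv₀ hp).2 (pow_le_one₀ hε.le hε1)
  have h3 : logTerm K T ε ≤ Real.log (4 * K * (T : ℝ) ^ 2 * (ε ^ (K - 1))⁻¹) := by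
    refine Real.log_le_log (by positivity) ?_
    calc 2 * K * (T : ℝ) ^ 2 * ((ε ^ (K - 1))⁻¹ + 1)
        ≤ 2 * K * (T : ℝ) ^ 2 * ((ε ^ (K - 1))⁻¹ + (ε ^ (K - 1))⁻¹) := by gcongr
      _ = _ := by ring
  rw [Real.log_mul (by positivity) (by positivity), Real.log_mul (by positivity) (by positivity),
    Real.log_mul (by positivity) (by positivity), Real.log_inv, Real.log_pow, Real.log_pow] at h3
  have h4 : Real.log 4 ≤ 4 := by
    have := Real.log_le_sub_one_of_pos (show (0 : ℝ) < 4 by norm_num)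
    linarith
  have h5 : Real.log K ≤ K := by
    have := Real.log_le_sub_one_of_pos (show (0 : ℝ) < K by linarith)
    linarith
  have hKl : (K : ℝ) ≤ K * Real.log T := by nlinarith
  have hlK : Real.log T ≤ K * Real.log T := by nlinarith
  have hK1 : ((K - 1 : ℕ) : ℝ) ≤ K := by exact_mod_cast Nat.sub_le K 1
  have h6 : ((K - 1 : ℕ) : ℝ) * -Real.log ε ≤ K * (A * Real.log T) :=
    mul_le_mul hK1 hlog (neg_nonneg.2 (Real.log_nonpos hε.le hε1)) (by linarith)
  push_cast at h3
  nlinarith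

lemma neg_log_level_le (hq : 0 < q) (hβ : 0 < β) (hc₁ : 0 < c₁) {K T : ℕ}
    (hK : 2 ≤ K) (hT : 3 ≤ T) {ε : ℝ} (h : c₁ * levelOrder q r β K T ≤ ε) :
    -Real.log ε ≤ (|Real.log c₁| + gammaExp β r * (q / (2 * β))) * Real.log T := by
  have h0 := one_le_log_of_three_le hT
  have h2 : (0 : ℝ) < T := by exact_mod_cast (by omega : 0 < T)
  have h3 : c₁ * ((T : ℝ) ^ (-gammaExp β r)) ^ (q / (2 * β)) ≤ ε := by
    refine le_trans ?_ h
    rw [levelOrder_eq]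
    gcongr
    exact rpow_neg_gammaExp_le_levelBase hq hK hT
  have h4 := Real.log_le_log (by positivity) h3
  rw [Real.log_mul hc₁.ne' (by positivity), Real.log_rpow (by positivity), Real.log_rpow h2] at h4
  have h5 := neg_abs_le (Real.log c₁)
  nlinarith [abs_nonneg (Real.log c₁)]

/-- The level bound gives `ε ^ β ≥ c₁ ^ β * M ^ (q / 2)` with `M` the level base, and the outer
exponent `2 / q` turns `M ^ (q / 2)` into `M`. -/
lemma rpow_ratio_le (hq : 0 < q) (hβ : 0 < β) (hL : 0 ≤ L) (hc : 0 < cgap)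
    (hc₁ : 0 < c₁) {K T : ℕ} (hK : 2 ≤ K) (hT : 3 ≤ T) {ε Δ : ℝ}
    (h : c₁ * levelOrder q r β K T ≤ ε) (hΔ : cgap * ε ^ β ≤ Δ) :
    (2 * K * L / Δ) ^ (2 / q)
      ≤ (2 * L / (cgap * c₁ ^ β)) ^ (2 / q) * ((K : ℝ) ^ (2 / q) / levelBase q r β K T) := by
  have hM := levelBase_pos q r β hK hT
  set M := levelBase q r β K T
  have h1 : (0 : ℝ) < K := by exact_mod_cast (by omega : 0 < K)
  have h2 : cgap * (c₁ ^ β * M ^ (q / 2)) ≤ Δ := by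
    refine le_trans ?_ hΔ
    gcongr
    have e : M ^ (q / 2) = (levelOrder q r β K T) ^ β := by
      rw [levelOrder_eq, ← Real.rpow_mul hM.le]
      congr 1
      field_simp
    have hlev := (levelOrder_pos q r β hK hT).le
    rw [e, ← Real.mul_rpow hc₁.le hlev]
    exact Real.rpow_le_rpow (mul_nonneg hc₁.le hlev) h hβ.le
  have hpos : 0 < cgap * (c₁ ^ β * M ^ (q / 2)) := by positivity
  have hΔ0 : 0 < Δ := hpos.trans_le h2
  calc (2 * K * L / Δ) ^ (2 / q)
      ≤ (2 * K * L / (cgap * (c₁ ^ β * M ^ (q / 2)))) ^ (2 / q) := by gcongr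
    _ = (2 * L / (cgap * c₁ ^ β) * (K / M ^ (q / 2))) ^ (2 / q) := by
      congr 1
      field_simp
    _ = _ := by
      rw [Real.mul_rpow (by positivity) (by positivity),
        Real.div_rpow h1.le (by positivity), ← Real.rpow_mul hM.le]
      congr 3
      rw [div_mul_div_comm, mul_comm q 2, div_self (by positivity), Real.rpow_one]

/-- The exploration length, and the number of arms, are at most of the order `T ^ γ`. -/
lemma exists_explorationLength_le (hq : 0 < q) (hr : 0 < r) (hβ : 0 < β) (hL : 0 ≤ L)
    (hc : 0 < cgap) (hc₁ : 0 < c₁) :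
    ∃ A : ℝ, 0 ≤ A ∧ ∀ (K T : ℕ) (ε Δ : ℝ), 2 ≤ K → 3 ≤ T → 0 < ε → ε ≤ 1 →
      c₁ * levelOrder q r β K T ≤ ε → cgap * ε ^ β ≤ Δ →
      explorationLength K q L Δ ε T ≤ A * (T : ℝ) ^ gammaExp β r ∧
        (K : ℝ) ≤ A * (T : ℝ) ^ gammaExp β r := by
  have hγ := gammaExp_pos hβ hr
  set A₁ : ℝ := c₁⁻¹ ^ (2 * β / q)
  set A₂ : ℝ := |Real.log c₁| + gammaExp β r * (q / (2 * β)) with hA₂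
  set A₃ : ℝ := (2 * L / (cgap * c₁ ^ β)) ^ (2 / q)
  set A₄ : ℝ := 256 * Real.exp 1 * A₃ * (2 * (1024 + (7 + A₂)))
  have p1 : 0 ≤ A₁ := by positivity
  have p2 : 0 ≤ A₂ := by positivity
  have p3 : 0 ≤ A₃ := by positivity
  have p4 : 0 ≤ A₄ := by positivity
  refine ⟨A₁ + A₄, by positivity, fun K T ε Δ hK hT hε hε1 hlev hΔ => ?_⟩
  have h0 := one_le_log_of_three_le hT
  have h1 : (1 : ℝ) ≤ K := by exact_mod_cast (by omega : 1 ≤ K)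
  have h2 : (0 : ℝ) < T := by exact_mod_cast (by omega : 0 < T)
  have hTγ : 0 < (T : ℝ) ^ gammaExp β r := by positivity
  have hM := levelBase_pos q r β hK hT
  constructor
  · have hΛ := logTerm_le hK hT hε hε1 (neg_log_level_le hq hβ hc₁ hK hT hlev)
    have hΛ0 : 0 ≤ logTerm K T ε := by
      refine Real.log_nonneg ?_
      have : (3 : ℝ) ≤ T := by exact_mod_cast hT
      have hp : 0 ≤ (ε ^ (K - 1))⁻¹ := by positivity
      calc (1 : ℝ) = 1 * 1 * 1 ^ 2 * (0 + 1) := by norm_num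
        _ ≤ _ := by gcongr <;> linarith
    have hK1 : 1 ≤ K * Real.log T := by nlinarith
    have hsq : (32 / √(Real.exp 1) + √(logTerm K T ε)) ^ 2
        ≤ 2 * (1024 + (7 + A₂)) * (K * Real.log T) := by
      have e1 : 32 / √(Real.exp 1) ≤ 32 := by
        refine div_le_self (by norm_num) (Real.one_le_sqrt.2 (Real.one_le_exp zero_le_one))
      have e0 : 0 ≤ 32 / √(Real.exp 1) := by positivity
      have e2 := Real.sq_sqrt hΛ0
      have e3 : (32 / √(Real.exp 1)) ^ 2 ≤ 1024 := by nlinarith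
      nlinarith [sq_nonneg (32 / √(Real.exp 1) - √(logTerm K T ε))]
    have hrat := rpow_ratio_le (r := r) hq hβ hL hc hc₁ hK hT hlev hΔ
    have hΔ0 : 0 < Δ := lt_of_lt_of_le (by positivity) hΔ
    calc explorationLength K q L Δ ε T
        = 256 * K * Real.exp 1 * (2 * K * L / Δ) ^ (2 / q)
          * (32 / √(Real.exp 1) + √(logTerm K T ε)) ^ 2 := rfl
      _ ≤ 256 * K * Real.exp 1 * (A₃ * ((K : ℝ) ^ (2 / q) / levelBase q r β K T))
          * (2 * (1024 + (7 + A₂)) * (K * Real.log T)) := by gcongr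
      -- One `K` is the prefactor of the length, one comes from the logarithmic term, and `K ^ (2 /
      -- q)` from the gap ratio. Together with `log T` they are exactly the factors in `levelBase`,
      -- which leaves `T ^ γ`.
      _ = A₄ * (K * K * (K : ℝ) ^ (2 / q) * Real.log T / levelBase q r β K T) := by
        simp only [A₄]
        ring
      _ = A₄ * (T : ℝ) ^ gammaExp β r := by
        congr 1
        rw [div_eq_iff hM.ne', levelBase, Real.rpow_add (by linarith), Real.rpow_neg h2.le,
          Real.rpow_two]
        field_simp
      _ ≤ (A₁ + A₄) * (T : ℝ) ^ gammaExp β r := by gcongr; linarith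
  · refine (natCast_le_of_level_le_one hq hβ hc₁ hK hT (hlev.trans hε1)).trans ?_
    gcongr
    linarith

/-- The exploration length suffices for the precision that the minimum gap requires. -/
lemma precision_of_explorationLength (hq : 0 < q) (hL : 0 < L) {K T : ℕ} (hK : 2 ≤ K)
    {ε Δ : ℝ} (hΔ : 0 < Δ) {m : ℕ}
    (hm : explorationLength K q L Δ ε T / K ≤ m) :
    4 + 2 * √(logTerm K T ε) ≤ √m * (Δ / (4 * L)) ^ (1 / q) := by
  have h1 : (2 : ℝ) ≤ K := by exact_mod_cast hK
  set t := (Δ / (4 * L)) ^ (1 / q)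
  have ht : 0 < t := by positivity
  -- The precision needs only `4 * L / Δ`, and `4 ≤ 2 * K` because there are at least two arms.
  have ht2 : (t ^ 2)⁻¹ ≤ (2 * K * L / Δ) ^ (2 / q) := by
    have e : (t ^ 2)⁻¹ = (4 * L / Δ) ^ (2 / q) := by
      rw [← Real.rpow_natCast t, ← Real.rpow_mul (by positivity), ← Real.inv_rpow (by positivity),
        inv_div]
      congr 1
      push_cast
      ring
    rw [e]
    gcongr
    linarith
  set R := 32 / √(Real.exp 1) + √(logTerm K T ε) with hR
  have hexp : 1 ≤ √(Real.exp 1) := Real.one_le_sqrt.2 (Real.one_le_exp zero_le_one)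
  have hR0 : 0 ≤ R := by positivity
  have hm' : 256 * Real.exp 1 * (t ^ 2)⁻¹ * R ^ 2 ≤ m := by
    refine le_trans ?_ hm
    rw [le_div_iff₀ (by linarith)]
    calc 256 * Real.exp 1 * (t ^ 2)⁻¹ * R ^ 2 * K
        ≤ 256 * Real.exp 1 * (2 * K * L / Δ) ^ (2 / q) * R ^ 2 * K := by gcongr
      _ = explorationLength K q L Δ ε T := by
        rw [explorationLength, ← logTerm, ← hR]
        ring
  have h2 : 16 * √(Real.exp 1) * R ≤ √m * t := by
    rw [← div_le_iff₀ ht]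
    refine Real.le_sqrt_of_sq_le (le_trans (le_of_eq ?_) hm')
    rw [div_pow, mul_pow, mul_pow, Real.sq_sqrt (Real.exp_pos 1).le]
    field_simp
    ring
  have h3 : √(Real.exp 1) * R = 32 + √(Real.exp 1) * √(logTerm K T ε) := by
    rw [hR, mul_add, mul_div_cancel₀]
    linarith
  nlinarith [Real.sqrt_nonneg (logTerm K T ε)]

/-- With `l = logTerm`, the union bound over the arms makes the failure probability at most `1 / T`.
-/
lemma logTerm_nonneg_and_exp_neg_le {K T : ℕ} (hK : 2 ≤ K) (hT : 3 ≤ T) {ε : ℝ} (hε : 0 < ε) :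
    0 ≤ logTerm K T ε ∧ K * Real.exp (-logTerm K T ε) ≤ (T : ℝ)⁻¹ := by
  have h1 : (2 : ℝ) ≤ K := by exact_mod_cast hK
  have h2 : (3 : ℝ) ≤ T := by exact_mod_cast hT
  have hp : 0 ≤ (ε ^ (K - 1))⁻¹ := by positivity
  have h3 : (K : ℝ) * T ≤ 2 * K * (T : ℝ) ^ 2 * ((ε ^ (K - 1))⁻¹ + 1) := by
    calc (K : ℝ) * T = 1 * K * T * (0 + 1) := by ring
      _ ≤ _ := by
        gcongr
        · norm_num
        · nlinarith
  have h4 : 0 < 2 * K * (T : ℝ) ^ 2 * ((ε ^ (K - 1))⁻¹ + 1) := by positivity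
  constructor
  · exact Real.log_nonneg (le_trans (by nlinarith) h3)
  · rw [logTerm, Real.exp_neg, Real.exp_log h4]
    calc (K : ℝ) * (2 * K * (T : ℝ) ^ 2 * ((ε ^ (K - 1))⁻¹ + 1))⁻¹
        ≤ K * (K * T : ℝ)⁻¹ := by gcongr
      _ = (T : ℝ)⁻¹ := by field_simp

/-! ### The order of the regret -/

/-- The discretization loss is of the order of the regret bound. -/
lemma mul_levelOrder_rpow (hq : 0 < q) (hβ : 0 < β) {K T : ℕ} (hK : 2 ≤ K) (hT : 3 ≤ T) :
    (K * levelOrder q r β K T) ^ r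
      = ((K : ℝ) ^ cE β q * Real.log T / (T : ℝ) ^ gammaExp β r) ^ (q * r / (2 * β)) := by
  have h0 := one_le_log_of_three_le hT
  have h1 : (0 : ℝ) < K := by exact_mod_cast (by omega : 0 < K)
  have h2 : (0 : ℝ) < T := by exact_mod_cast (by omega : 0 < T)
  have hM := levelBase_pos q r β hK hT
  have e1 : (K : ℝ) ^ cE β q * Real.log T / (T : ℝ) ^ gammaExp β r
      = (K : ℝ) ^ (2 * β / q) * levelBase q r β K T := by
    -- The factor `K` in front of the level becomes `K ^ (2 * β / q)` inside the power `q / (2 *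
    -- β)`, which accounts for the excess of `cE` over `2 + 2 / q`.
    rw [levelBase, show cE β q = 2 * β / q + (2 + 2 / q) by unfold cE; field_simp; ring,
      Real.rpow_add h1, Real.rpow_neg h2.le]
    ring
  rw [e1, levelOrder_eq, Real.mul_rpow h1.le (Real.rpow_nonneg hM.le _),
    Real.mul_rpow (Real.rpow_nonneg h1.le _) hM.le, ← Real.rpow_mul hM.le, ← Real.rpow_mul h1.le]
  congr 2 <;> field_simp

/-- This is the commitment loss: `1 - γ = γ r/(2β)` identifies the powers of `T`, and the remaining
factors `K ^ cE` and `log T` are at least `1`. -/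
lemma rpow_le_regretOrder (hq : 0 < q) (hr : 0 < r) (hβ : 0 < β) {K T : ℕ} (hK : 2 ≤ K)
    (hT : 3 ≤ T) :
    (T : ℝ) ^ ((gammaExp β r - 1) * q)
      ≤ ((K : ℝ) ^ cE β q * Real.log T / (T : ℝ) ^ gammaExp β r) ^ (q * r / (2 * β)) := by
  have h0 := one_le_log_of_three_le hT
  have h1 : (1 : ℝ) ≤ K := by exact_mod_cast (by omega : 1 ≤ K)
  have h2 : (0 : ℝ) < T := by exact_mod_cast (by omega : 0 < T)
  have e : (gammaExp β r - 1) * q = -gammaExp β r * (q * r / (2 * β)) := by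
    unfold gammaExp
    field_simp
    ring
  rw [e, Real.rpow_mul h2.le]
  refine Real.rpow_le_rpow (by positivity) ?_ (by positivity)
  rw [Real.rpow_neg h2.le, ← one_div]
  gcongr
  have : 1 ≤ (K : ℝ) ^ cE β q := Real.one_le_rpow h1 (by unfold cE; positivity)
  nlinarith

lemma inv_le_regretOrder (hq : 0 < q) (hq1 : q ≤ 1) (hr : 0 < r) (hβ : 0 < β) {K T : ℕ}
    (hK : 2 ≤ K) (hT : 3 ≤ T) :
    (T : ℝ)⁻¹
      ≤ ((K : ℝ) ^ cE β q * Real.log T / (T : ℝ) ^ gammaExp β r) ^ (q * r / (2 * β)) := by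
  refine le_trans ?_ (rpow_le_regretOrder hq hr hβ hK hT)
  have h2 : (1 : ℝ) ≤ T := by exact_mod_cast (by omega : 1 ≤ T)
  rw [← Real.rpow_neg_one]
  refine Real.rpow_le_rpow_of_exponent_le h2 ?_
  nlinarith [gammaExp_pos hβ hr, gammaExp_lt_one hβ hr]

end Asymptotics

end RSBandit

/-! ### Choice of the constants and assembly of the regret bound. -/

theorem theorem2
    (q r β LH LMH B Wmax cgap c₁ c₂ : ℝ)
    (hq : 0 < q) (hq1 : q ≤ 1) (hr : 0 < r) (hβ : 0 < β)
    (hLH : 0 ≤ LH) (hLMH : 0 ≤ LMH) (hcgap : 0 < cgap) (hc₁ : 0 < c₁) :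
    -- the constants below depend on the parameters above only, not on `K` and the instance
    ∃ (C : ℝ) (T₀ : ℕ),
      ∀ (K : ℕ) (h : ℝ → ℝ) (S : Set ℝ) (F : Fin K → Measure ℝ) (αs : Fin K → ℝ) (E : Set ℝ),
        StandingAssumptions q r LH LMH B Wmax h S F αs →
        -- the levels in `E` are admissible, the gap exponent exists, and the gap is `Ω(ε ^ β)`
        E ⊆ Set.Ioc 0 1 →
        HasGapExponent h F E β →
        (∀ ε ∈ E, cgap * ε ^ β ≤ minGap h F ε) →
        ∀ (T : ℕ) (ε : ℝ), T₀ ≤ T → ε ∈ E →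
          c₁ * levelOrder q r β K T ≤ ε → ε ≤ c₂ * levelOrder q r β K T →
          ∀ N : ℝ, N = explorationLength K q (max LH LMH) (minGap h F ε) ε T →
            -- the exploration phase fits into the horizon
            N < T ∧ K * ⌈N / K⌉₊ ≤ T ∧
            -- the regret bound, for every execution of the algorithm
            ∀ {Ω : Type*} [MeasurableSpace Ω] (P : Measure Ω) [IsProbabilityMeasure P]
              (X : Fin K → ℕ → Ω → ℝ) (A : ℕ → Ω → Fin K),
              IsRewardModel P F X →
              (∀ t, Measurable (A t)) →
              (∀ᵐ ω ∂P, FollowsRSETCM h ε N T (fun i n => X i n ω) (fun t => A t ω)) →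
              regret P h F αs A T
                ≤ C * ((K : ℝ) ^ cE β q * Real.log T / (T : ℝ) ^ gammaExp β r)
                    ^ (q * r / (2 * β)) := by
  have hL : 0 ≤ max LH LMH := hLH.trans (le_max_left _ _)
  obtain ⟨a, ha0, ha⟩ := exists_explorationLength_le hq hr hβ hL hcgap hc₁
  have hγ1 := gammaExp_lt_one hβ hr
  -- Both `N` and `K` are at most `a * T ^ γ`, so `K * ⌈N / K⌉₊ ≤ N + K ≤ 2 * a * T ^ γ`; since `γ <
  -- 1`, this is below `T` eventually.
  obtain ⟨T₁, hT₁⟩ : ∃ T₁ : ℕ, ∀ T : ℕ, T₁ ≤ T → 2 * a < (T : ℝ) ^ (1 - gammaExp β r) := by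
    have := ((tendsto_rpow_atTop (sub_pos.2 hγ1)).comp
      tendsto_natCast_atTop_atTop).eventually_gt_atTop (2 * a)
    exact eventually_atTop.1 this
  -- One summand per loss. The `6 * a` comes from `2 * (K * m + K) ≤ 2 * (N + 2 * K) ≤ 6 * a * T ^
  -- γ`. The absolute values are there because the constant is fixed before any instance supplies
  -- signs.
  refine ⟨LMH * (2 * Wmax * |c₂|) ^ r + LH * (Wmax * (6 * a)) ^ q + |B|, max 3 T₁, ?_⟩
  intro K h S F αs E sa hE _ hgapE T ε hT hεE hlo hhi N hN
  have hT3 : 3 ≤ T := (le_max_left _ _).trans hT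
  obtain ⟨hε, hε1⟩ := hE hεE
  have hK := sa.two_le
  have hK' : (2 : ℝ) ≤ K := by exact_mod_cast hK
  have hT' : (3 : ℝ) ≤ T := by exact_mod_cast hT3
  have hΔ := hgapE ε hεE
  have hgap : 0 < minGap h F ε := lt_of_lt_of_le (by positivity) hΔ
  obtain ⟨hNle, hKle⟩ := ha K T ε _ hK hT3 hε hε1 hlo hΔ
  rw [← hN] at hNle
  have hTsplit : (T : ℝ) = (T : ℝ) ^ (1 - gammaExp β r) * (T : ℝ) ^ gammaExp β r := by
    rw [← Real.rpow_add (by linarith)]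
    simp
  have hTγ : 0 < (T : ℝ) ^ gammaExp β r := by positivity
  have hlt : 2 * a * (T : ℝ) ^ gammaExp β r < T := by
    conv_rhs => rw [hTsplit]
    exact mul_lt_mul_of_pos_right (hT₁ T ((le_max_right _ _).trans hT)) hTγ
  have hLpos : 0 < LH := sa.LH_pos hgap
  have hLmax : 0 < max LH LMH := hLpos.trans_le (le_max_left _ _)
  have hN0 : 0 < N := by
    rw [hN, explorationLength]
    positivity
  have hm : K * (⌈N / K⌉₊ : ℝ) ≤ N + K := by
    have := (Nat.ceil_lt_add_one (div_nonneg hN0.le (by linarith : (0 : ℝ) ≤ K))).le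
    calc K * (⌈N / K⌉₊ : ℝ) ≤ K * (N / K + 1) := by gcongr
      _ = N + K := by field_simp
  have hmT : K * ⌈N / K⌉₊ ≤ T := by
    have : (K : ℝ) * (⌈N / K⌉₊ : ℝ) ≤ T := by linarith
    exact_mod_cast this
  refine ⟨by nlinarith, hmT, ?_⟩
  intro Ω _ P _ X A hX hA hfol
  obtain ⟨hl0, hl1⟩ := logTerm_nonneg_and_exp_neg_le hK hT3 hε
  have hprec : 4 + 2 * √(logTerm K T ε)
      ≤ √(⌈N / K⌉₊ : ℕ) * (minGap h F ε / (4 * max LH LMH)) ^ (1 / q) :=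
    precision_of_explorationLength hq hLmax hK hgap (by rw [← hN]; exact Nat.le_ceil _)
  -- The tolerance `(Δ / (4 * L)) ^ (1 / q)` makes each Hölder error at most `Δ / 4`, strictly below
  -- the `Δ / 2` required for a correct selection.
  have htΔ : LH * ((minGap h F ε / (4 * max LH LMH)) ^ (1 / q)) ^ q < minGap h F ε / 2 := by
    rw [← Real.rpow_mul (by positivity), one_div, inv_mul_cancel₀ hq.ne', Real.rpow_one]
    calc LH * (minGap h F ε / (4 * max LH LMH))
        ≤ max LH LMH * (minGap h F ε / (4 * max LH LMH)) := by
          gcongr; exact le_max_left _ _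
      _ = minGap h F ε / 4 := by field_simp
      _ < minGap h F ε / 2 := by linarith
  refine (sa.regret_le hq hr hLH hLMH hε hgap (by omega)
    (Nat.ceil_pos.2 (div_pos hN0 (by linarith))) rfl hmT hl0 hprec htΔ hX hA hfol).trans ?_
  have hW := sa.Wmax_nonneg
  have hlev := (levelOrder_pos q r β hK hT3).le
  set Z := ((K : ℝ) ^ cE β q * Real.log T / (T : ℝ) ^ gammaExp β r) ^ (q * r / (2 * β)) with hZ
  have t1 : (Wmax * (2 * K * ε)) ^ r ≤ (2 * Wmax * |c₂|) ^ r * Z := by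
    rw [hZ, ← mul_levelOrder_rpow hq hβ hK hT3, ← Real.mul_rpow (by positivity) (by positivity)]
    refine Real.rpow_le_rpow (by positivity) ?_ hr.le
    calc Wmax * (2 * K * ε) ≤ Wmax * (2 * K * (|c₂| * levelOrder q r β K T)) := by
          gcongr
          exact hhi.trans (mul_le_mul_of_nonneg_right (le_abs_self _) hlev)
      _ = _ := by ring
  have t2 : (Wmax * (2 * (K * (⌈N / K⌉₊ : ℕ) + K) / T)) ^ q ≤ (Wmax * (6 * a)) ^ q * Z := by
    refine le_trans ?_ (mul_le_mul_of_nonneg_left (rpow_le_regretOrder hq hr hβ hK hT3)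
      (by positivity))
    rw [Real.rpow_mul (by positivity), ← Real.mul_rpow (by positivity) (by positivity)]
    refine Real.rpow_le_rpow (by positivity) ?_ hq.le
    rw [mul_assoc Wmax]
    refine mul_le_mul_of_nonneg_left ?_ hW
    rw [Real.rpow_sub_one (by positivity), ← mul_div_assoc,
      div_le_div_iff_of_pos_right (by positivity)]
    linarith
  have t3 := inv_le_regretOrder hq hq1 hr hβ hK hT3
  have t4 : B * (K * Real.exp (-logTerm K T ε)) ≤ |B| * Z :=
    mul_le_mul (le_abs_self B) (hl1.trans t3) (by positivity) (abs_nonneg B)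
  have t1' := mul_le_mul_of_nonneg_left t1 hLMH
  have t2' := mul_le_mul_of_nonneg_left t2 hLH
  linarith
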